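/- Let $(K,\nu)$ be a henselian valued field (of arbitrary rank), and let $L_1/K$ and $L_2/K$ be finite tame extensions inside a common extension field. Let $L = L_1\cdot L_2$ be their compositum, and denote also by $\nu$ the extension of $\nu$ to $L$. For a subfield $F$ of $L$ containing $K$, write $\nu F$ for the value group, $F\nu$ for the residue field and $\mathfrak{O}_F$ for the valuation ring of $(F,\nu)$; for $\theta\in\mathfrak{O}_F$ write $\theta\nu\in F\nu$ for its residue. Here an algebraic extension $(E/F,\nu)$ of henselian valued fields with residue characteristic exponent $p$ ($p=\operatorname{char} F\nu$ if this is positive, and $p=1$ otherwise) is *tame* if for every finite subextension $M/F$: the index $[\nu M:\nu F]$ is coprime to $p$, the extension $M\nu/F\nu$ is separable, and $[M:F]=[\nu M:\nu F]\,[M\nu:F\nu]$. It is *unramified* if it is tame and $\nu E=\nu F$. Set $e_i=[\nu L_i:\nu K]$ for $i=1,2$, and for $\theta\in\mathfrak{O}_L$ set $d_\theta=[L_1\nu(\theta\nu):L_1\nu]$. Then $$(L/L_2,\nu)\text{ is unramified}\iff e_2\,d_\theta=e_1\,[L:L_1]\text{ for some }\theta\in\mathfrak{O}_L.$$ Moreover,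 for every $\theta\in\mathfrak{O}_L$ with $e_2\,d_\theta=e_1\,[L:L_1]$, one has $L\nu=L_1\nu(\theta\nu)$, and $e_1$ divides $e_2$. -/

import Mathlib

open IsLocalRing

/-- The restriction to `F` of a valuation `v` on an extension field `E` of `F`. -/
abbrev resVal (F : Type*) {E Γ : Type*} [Field F] [Field E] [Algebra F E]
    [LinearOrderedCommGroupWithZero Γ] (v : Valuation E Γ) : Valuation F Γ :=
  v.comap (algebraMap F E)

/-- A valuation extends its restriction. This makes Mathlib's map of residue fields `Fν → Eν`
available as an algebra structure. -/
instance resVal_hasExtension (F : Type*) {E Γ : Type*} [Field F] [Field E] [Algebra F E]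
    [LinearOrderedCommGroupWithZero Γ] (v : Valuation E Γ) : (resVal F v).HasExtension v :=
  ⟨Valuation.IsEquiv.refl⟩

/-- The residue field of a valued field `(F, v)`. -/
abbrev ResField {F Γ : Type*} [Field F] [LinearOrderedCommGroupWithZero Γ]
    (v : Valuation F Γ) : Type _ :=
  ResidueField v.valuationSubring

/-- The value group `v(Fˣ)` of a valued field `(F, v)`, as a subgroup of `Γˣ` (the valuation is
written multiplicatively, and need not be surjective). -/
abbrev valGroup {F Γ : Type*} [Field F] [LinearOrderedCommGroupWithZero Γ]
    (v : Valuation F Γ) : Subgroup Γˣ :=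
  MonoidWithZeroHom.valueGroup (MonoidWithZeroHom.ofClass v)

/-- The ramification index `[vE : vF]` of an extension `(E/F, v)` of valued fields. -/
noncomputable def ramIndex (F : Type*) {E Γ : Type*} [Field F] [Field E] [Algebra F E]
    [LinearOrderedCommGroupWithZero Γ] (v : Valuation E Γ) : ℕ :=
  (valGroup (resVal F v)).relIndex (valGroup v)

/-- The residue degree `[Ev : Fv]` of an extension `(E/F, v)` of valued fields. -/
noncomputable def resDegree (F : Type*) {E Γ : Type*} [Field F] [Field E] [Algebra F E]
    [LinearOrderedCommGroupWithZero Γ] (v : Valuation E Γ) : ℕ :=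
  Module.finrank (ResField (resVal F v)) (ResField v)

/-- The algebraic extension `(E/F, v)` of valued fields is tame: for every finite subextension
`M/F`, the ramification index is not divisible by the residue characteristic (no condition in
residue characteristic zero, where the residue characteristic exponent is `1`), the residue field
extension is separable, and the extension is defectless, that is `[M : F] = [vM : vF] [Mv : Fv]`. -/
def IsTameExt (F : Type*) {E Γ : Type*} [Field F] [Field E] [Algebra F E]
    [LinearOrderedCommGroupWithZero Γ] (v : Valuation E Γ) : Prop :=
  Algebra.IsAlgebraic F E ∧
    ∀ M : IntermediateField F E, FiniteDimensional F M →
      (ringExpChar (ResField (resVal F (resVal M v)))).Coprime (ramIndex F (resVal M v)) ∧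
      Algebra.IsSeparable (ResField (resVal F (resVal M v))) (ResField (resVal M v)) ∧
      Module.finrank F M = ramIndex F (resVal M v) * resDegree F (resVal M v)

/-- The extension `(E/F, v)` is unramified: it is tame and `vE = vF`. -/
def IsUnramifiedExt (F : Type*) {E Γ : Type*} [Field F] [Field E] [Algebra F E]
    [LinearOrderedCommGroupWithZero Γ] (v : Valuation E Γ) : Prop :=
  IsTameExt F v ∧ valGroup v = valGroup (resVal F v)

/-- The residue field `Fv(θv)`, for `θ` in the valuation ring of `E`, as an intermediate field
of `Ev / Fv`. -/
noncomputable def resAdjoin (F : Type*) {E Γ : Type*} [Field F] [Field E] [Algebra F E]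
    [LinearOrderedCommGroupWithZero Γ] (v : Valuation E Γ) (θ : v.valuationSubring) :
    IntermediateField (ResField (resVal F v)) (ResField v) :=
  IntermediateField.adjoin (ResField (resVal F v)) {residue v.valuationSubring θ}

/-! Write e(·) and f(·) for ramification index and residue degree. Once `L/L₁` and `L/L₂` are known
to be tame, the theorem is a count. Multiplicativity of e in the two towers gives e₁ · e(L/L₁) = e₂
· e(L/L₂), and defectlessness gives [L:L₁] = e(L/L₁) · f(L/L₁). Hence e₂ d_θ = e₁ [L:L₁] says
exactly d_θ = e(L/L₂) · f(L/L₁). Since d_θ ≤ f(L/L₁), this forces e(L/L₂) = 1 and d_θ = f(L/L₁), so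
`θν` generates `Lν` and e₁ divides e₂. Conversely, if e(L/L₂) = 1, the residue of a suitable θ is a
primitive element of the separable extension `Lν/L₁ν`.

The substance is that tameness survives base change (`TameSubfield.base_change`). Given `B/A` tame
and `A ≤ C`, take a tame extension `F` of `C` of maximal degree. By maximality `F` absorbs integral
simple roots (`exists_tameSubfield_of_simple_root`) and roots of order prime to the residue
characteristic (`exists_tameSubfield_of_pow_mem`). Such elements realise all residues and values of
`B` inside `F ∩ B`, so defectlessness gives `B ≤ F` (`TameSubfield.le_of_closed`). The degree counts
rest on the fundamental inequality e f ≤ n (`relIndex_mul_relfinrank_le`).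

Hensel's lemma is needed in every field between `K` and `L`, while only the valuation ring of `K` is
assumed henselian. It is inherited because the integral closure of that ring in a finite extension
is local, hence a valuation ring, hence the only one extending it. Its uniqueness makes it Galois
invariant, and a simple root with prescribed residue is then fixed by all automorphisms. -/

open Polynomial in
/-- A product of linear factors `X - r` with all `r` in the ideal `M` takes a value congruent to `1`
modulo `M` at every point congruent to `1` modulo `M`. -/
theorem Ideal.eval_prod_X_sub_C_sub_one_mem {B : Type*} [CommRing B] (M : Ideal B)
    (s : Multiset B) (hs : ∀ r ∈ s, r ∈ M) (x : B) (hx : x - 1 ∈ M) :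
    ((s.map fun r => X - C r).prod).eval x - 1 ∈ M := by
  induction s using Multiset.induction with
  | empty => simp
  | cons a s ih =>
    have h1 := ih fun r hr => hs r (Multiset.mem_cons_of_mem hr)
    have h2 := hs a (Multiset.mem_cons_self a s)
    rw [Multiset.map_cons, Multiset.prod_cons, eval_mul]
    set y := ((s.map fun r => X - C r).prod).eval x
    have : (X - C a).eval x * y - 1 = (x - 1) * y - a * y + (y - 1) := by
      simp only [eval_sub, eval_X, eval_C]; ring
    rw [this]
    exact M.add_mem (M.sub_mem (M.mul_mem_right _ hx) (M.mul_mem_right _ h2)) h1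

theorem Ideal.exists_sub_one_mem_forall_mem {B : Type*} [CommRing B] (M : Ideal B) [M.IsMaximal]
    (S : Finset (Ideal B)) (hS : ∀ J ∈ S, J.IsMaximal ∧ J ≠ M) :
    ∃ a : B, a - 1 ∈ M ∧ ∀ J ∈ S, a ∈ J := by
  have h : M ⊔ ⨅ J ∈ S, J = ⊤ := by
    refine Ideal.sup_iInf_eq_top fun J hJ => ?_
    have := (hS J hJ).1
    exact Ideal.IsMaximal.coprime_of_ne inferInstance this (hS J hJ).2.symm
  have h1 : (1 : B) ∈ M ⊔ ⨅ J ∈ S, J := h ▸ Submodule.mem_top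
  obtain ⟨m, hm, a, ha, hma⟩ := Submodule.mem_sup.1 h1
  refine ⟨a, ?_, fun J hJ => ?_⟩
  · rw [← hma, sub_add_cancel_right]
    exact M.neg_mem hm
  · simp only [Submodule.mem_iInf] at ha
    exact ha J hJ

/-! ### Integral closures of henselian local rings are local -/

section IntegralClosureLocal

variable {O K N : Type*} [CommRing O] [Field K] [Field N]
  [Algebra O K] [Algebra K N] [Algebra O N] [IsScalarTower O K N]

/-- The action of an automorphism on the integral closure. -/
abbrev integralClosureAut (O : Type*) {K N : Type*} [CommRing O] [Field K] [Field N]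
    [Algebra O K] [Algebra K N] [Algebra O N] [IsScalarTower O K N] (σ : N ≃ₐ[K] N) :
    integralClosure O N ≃ₐ[O] integralClosure O N :=
  (σ.restrictScalars O).mapIntegralClosure

/-- An element of the integral closure that separates a maximal ideal `M` from a maximal ideal
`M'` and from the nontrivial conjugates of `M`, and that is invariant under the decomposition
group of `M`. -/
theorem exists_separating_element [FiniteDimensional K N]
    (M M' : Ideal (integralClosure O N)) [hM : M.IsMaximal] (hM' : M'.IsMaximal) (hne : M' ≠ M) :
    ∃ a : integralClosure O N, a - 1 ∈ M ∧ a ∈ M' ∧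
      ∀ σ : N ≃ₐ[K] N, σ (a : N) = a ∨ integralClosureAut O σ a ∈ M := by
  classical
  set φ : (N ≃ₐ[K] N) → (integralClosure O N ≃ₐ[O] integralClosure O N) :=
    fun σ => integralClosureAut O σ with hφ
  have hφmul : ∀ σ τ x, φ (σ * τ) x = φ σ (φ τ x) := fun σ τ x => rfl
  let D : Subgroup (N ≃ₐ[K] N) :=
    { carrier := {τ | ∀ x, φ τ x ∈ M ↔ x ∈ M}
      one_mem' := fun x => Iff.rfl
      mul_mem' := fun {σ τ} hσ hτ x => by rw [hφmul, hσ, hτ]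
      inv_mem' := fun {σ} hσ x => by
        rw [← hσ, ← hφmul, mul_inv_cancel]; rfl }
  let S : Finset (Ideal (integralClosure O N)) :=
    ((Finset.univ.image fun σ => M.comap (φ σ)) ∪ {M'}).filter fun J => J ≠ M
  obtain ⟨b, hb1, hbS⟩ := Ideal.exists_sub_one_mem_forall_mem M S (by
    intro J hJ
    simp only [S, Finset.mem_filter, Finset.mem_union, Finset.mem_image, Finset.mem_univ, true_and,
      Finset.mem_singleton] at hJ
    refine ⟨?_, hJ.2⟩
    rcases hJ.1 with ⟨σ, rfl⟩ | rfl
    · exact Ideal.comap_isMaximal_of_surjective _ (φ σ).surjective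
    · exact hM')
  -- The product over the decomposition group `D` is `D`-invariant and still 1 modulo `M`. Its
  -- factor at τ = 1 is `b`, which lies in `M'` and in the preimage of `M` under every σ outside
  -- `D`.
  refine ⟨∏ τ : D, φ τ b, ?_, ?_, ?_⟩
  · rw [← Ideal.Quotient.eq, map_prod, map_one]
    refine Finset.prod_eq_one fun τ _ => ?_
    rw [← map_one (Ideal.Quotient.mk M), Ideal.Quotient.eq, ← map_one (φ τ), ← map_sub]
    exact (τ.2 _).2 hb1
  · rw [← Finset.mul_prod_erase _ _ (Finset.mem_univ (1 : D))]
    exact M'.mul_mem_right _ (hbS M' (by simp [S, hne]))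
  · intro σ
    by_cases hσ : σ ∈ D
    · left
      have h : φ σ (∏ τ : D, φ τ b) = ∏ τ : D, φ τ b := by
        rw [map_prod]
        exact Fintype.prod_equiv (Equiv.mulLeft (⟨σ, hσ⟩ : D)) _ _ fun τ => rfl
      exact congrArg Subtype.val h
    · right
      change φ σ _ ∈ M
      rw [map_prod, ← Finset.mul_prod_erase _ _ (Finset.mem_univ (1 : D))]
      refine M.mul_mem_right _ ?_
      have : b ∈ M.comap (φ σ) := by
        refine hbS _ ?_
        simp only [S, Finset.mem_filter, Finset.mem_union, Finset.mem_image, Finset.mem_univ,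
          true_and, exists_apply_eq_apply, true_or]
        intro h
        exact hσ fun x => by
          conv_rhs => rw [← h]
          rfl
      exact this

variable [IsDomain O] [IsIntegrallyClosed O] [IsFractionRing O K]

open Polynomial in
/-- The integral closure of a henselian local ring in a finite normal extension is local. -/
theorem isLocalRing_integralClosure_of_normal [HenselianLocalRing O] [FiniteDimensional K N]
    [Normal K N] : IsLocalRing (integralClosure O N) := by
  classical
  obtain ⟨M, hM⟩ := Ideal.exists_maximal (integralClosure O N)
  refine IsLocalRing.of_unique_max_ideal ⟨M, hM, fun M' hM' => ?_⟩
  by_contra hne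
  have hcm : ∀ I : Ideal (integralClosure O N), I.IsMaximal →
      I.comap (algebraMap O (integralClosure O N)) = maximalIdeal O := fun I hI =>
    IsLocalRing.eq_maximalIdeal (Ideal.isMaximal_comap_of_isIntegral_of_isMaximal I)
  obtain ⟨a, ha1, ha', haσ⟩ := exists_separating_element (K := K) M M' hM' hne
  -- A power of `a` by a power of the characteristic exponent is separable over `K` and keeps the
  -- other three properties. Separability makes the conjugates of `b` distinct roots, so all roots
  -- other than `b` lie in `M`.
  obtain ⟨b, hb1, hb', hbσ, hbsep⟩ : ∃ b : integralClosure O N, b - 1 ∈ M ∧ b ∈ M' ∧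
      (∀ σ : N ≃ₐ[K] N, σ (b : N) = b ∨ integralClosureAut O σ b ∈ M) ∧ IsSeparable K (b : N) := by
    obtain ⟨n, y, hy⟩ := IsPurelyInseparable.pow_mem (separableClosure K N) (ringExpChar K)
      (a : N)
    have hq : ringExpChar K ^ n ≠ 0 := pow_ne_zero _ (expChar_ne_zero K _)
    refine ⟨a ^ ringExpChar K ^ n, ?_, Ideal.pow_mem_of_mem _ ha' _ (Nat.pos_of_ne_zero hq),
      fun σ => (haσ σ).imp (fun h => ?_) fun h => ?_, ?_⟩
    · rw [← Ideal.Quotient.eq] at ha1 ⊢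
      rw [map_pow, ha1, map_one, one_pow]
    · simp [h]
    · rw [map_pow]; exact Ideal.pow_mem_of_mem _ h _ (Nat.pos_of_ne_zero hq)
    · have := mem_separableClosure_iff.1 y.2
      rwa [show ((y : separableClosure K N) : N) = _ from hy] at this
  have hbint : IsIntegral O (b : N) := b.2
  have hmin := minpoly.isIntegrallyClosed_eq_field_fractions' K hbint
  set f := minpoly O (b : N) with hf
  have hfm : f.Monic := minpoly.monic hbint
  have hsplit : ((minpoly K (b : N)).map (algebraMap K N)).Splits := Normal.splits inferInstance _
  have hKm : (minpoly K (b : N)).Monic := minpoly.monic hbint.tower_top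
  have hprod := hsplit.eq_prod_roots
  rw [(hKm.map _).leadingCoeff, C_1, one_mul] at hprod
  set t := ((minpoly K (b : N)).map (algebraMap K N)).roots with ht
  have htnodup : t.Nodup := nodup_roots (Polynomial.Separable.map hbsep)
  have hbt : (b : N) ∈ t := by
    rw [ht, mem_roots (hKm.map _).ne_zero, IsRoot, eval_map_algebraMap, minpoly.aeval]
  have htr : ∀ r ∈ t.erase (b : N), ∃ x : integralClosure O N, x ∈ M ∧ (x : N) = r := by
    intro r hr
    obtain ⟨hrb, hrt⟩ := htnodup.mem_erase_iff.1 hr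
    rw [ht, mem_roots (hKm.map _).ne_zero, IsRoot, eval_map_algebraMap] at hrt
    obtain ⟨σ, hσ⟩ := minpoly.exists_algEquiv_of_root' (Algebra.IsAlgebraic.isAlgebraic (b : N)) hrt
    rcases hbσ σ with h | h
    · exact absurd (hσ.symm.trans h) hrb
    · exact ⟨_, h, hσ⟩
  obtain ⟨s, hsM, hst⟩ : ∃ s : Multiset (integralClosure O N), (∀ r ∈ s, r ∈ M) ∧
      s.map (fun x : integralClosure O N => (x : N)) = t.erase (b : N) := by
    choose! g hg using htr
    refine ⟨(t.erase (b : N)).map g, ?_, ?_⟩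
    · intro r hr
      obtain ⟨x, hx, rfl⟩ := Multiset.mem_map.1 hr
      exact (hg x hx).1
    · rw [Multiset.map_map]
      conv_rhs => rw [← Multiset.map_id (t.erase (b : N))]
      exact Multiset.map_congr rfl fun x hx => (hg x hx).2
  set g : (integralClosure O N)[X] := (s.map fun r => X - C r).prod with hg
  have hfac : f.map (algebraMap O (integralClosure O N)) = (X - C b) * g := by
    apply Polynomial.map_injective (algebraMap (integralClosure O N) N)
      Subtype.val_injective
    rw [Polynomial.map_map, ← IsScalarTower.algebraMap_eq, IsScalarTower.algebraMap_eq O K N,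
      ← Polynomial.map_map, ← hmin, hprod, ← Multiset.cons_erase hbt, ← hst]
    simp only [Multiset.map_cons, Multiset.prod_cons, Polynomial.map_mul, Polynomial.map_sub, map_X,
      map_C, hg, Polynomial.map_multiset_prod, Multiset.map_map, Function.comp_def]
    rfl
  have hg1 := fun x hx => Ideal.eval_prod_X_sub_C_sub_one_mem M s hsM x hx
  rw [← hg] at hg1
  have hfev : ∀ c : O, algebraMap O (integralClosure O N) (f.eval c) =
      (algebraMap O _ c - b) * g.eval (algebraMap O _ c) := by
    intro c
    rw [← Polynomial.eval_map_apply, hfac]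
    simp
  have h10 : (1 : integralClosure O N) - 1 ∈ M := by simp
  -- Modulo `M`, f = (X - b) g with b ≡ 1 and g(1) ≡ 1, so 1 is a simple root of the reduction of
  -- `f`. The lifted root `c` satisfies g(c) ≡ 1, so c = b. Then `c` lies in `M'`, hence in the
  -- maximal ideal of `O`, although c ≡ 1.
  obtain ⟨c, hc0, hc1⟩ := HenselianLocalRing.is_henselian f hfm 1 (by
      rw [← hcm M hM, Ideal.mem_comap, hfev, map_one]
      refine M.mul_mem_right _ ?_
      rw [← neg_sub]; exact M.neg_mem hb1) (by
      rw [← IsLocalRing.notMem_maximalIdeal, ← hcm M hM, Ideal.mem_comap,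
        ← Polynomial.eval_map_apply, ← derivative_map, hfac, derivative_mul, map_one]
      simp only [derivative_sub, derivative_X, derivative_C, sub_zero, one_mul, eval_add, eval_mul,
        eval_sub, eval_X, eval_C]
      intro h
      refine hM.ne_top ((Ideal.eq_top_iff_one _).2 ?_)
      have h2 := M.sub_mem h (M.add_mem (hg1 1 h10) (M.mul_mem_right (g.derivative.eval 1)
        (M.neg_mem hb1)))
      convert h2 using 1
      ring)
  have hcM : algebraMap O (integralClosure O N) c - 1 ∈ M := by
    rw [← hcm M hM, Ideal.mem_comap, map_sub, map_one] at hc1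
    exact hc1
  have hgc : g.eval (algebraMap O (integralClosure O N) c) ≠ 0 := by
    intro h0
    have := hg1 _ hcM
    rw [h0, zero_sub] at this
    exact hM.ne_top ((Ideal.eq_top_iff_one _).2 (neg_mem_iff.1 this))
  have hcb : algebraMap O (integralClosure O N) c = b := by
    have := hfev c
    rw [hc0.eq_zero, map_zero, eq_comm, mul_eq_zero, or_iff_left hgc, sub_eq_zero] at this
    exact this
  have hcm' : c ∈ maximalIdeal O := by
    rw [← hcm M' hM', Ideal.mem_comap, hcb]; exact hb'
  have h1 : (1 : O) ∈ maximalIdeal O := by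
    have := (maximalIdeal O).sub_mem hcm' hc1
    rwa [sub_sub_cancel] at this
  exact (Ideal.ne_top_iff_one _).1 (IsLocalRing.maximalIdeal.isMaximal O).ne_top h1

/-- The integral closure of a henselian local ring in a finite extension is local. -/
theorem isLocalRing_integralClosure [HenselianLocalRing O] [FiniteDimensional K N] :
    IsLocalRing (integralClosure O N) := by
  let E := IntermediateField.normalClosure K N (AlgebraicClosure N)
  have : IsScalarTower O N E :=
    IsScalarTower.of_algebraMap_eq fun x => by
      rw [IsScalarTower.algebraMap_apply O K N, ← IsScalarTower.algebraMap_apply K N E,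
        ← IsScalarTower.algebraMap_apply O K E]
  have hloc := isLocalRing_integralClosure_of_normal (O := O) (K := K) (N := E)
  let ψ : integralClosure O N →ₐ[O] integralClosure O E :=
    (IsScalarTower.toAlgHom O N E).mapIntegralClosure
  have hψ : ∀ x, (ψ x : E) = algebraMap N E x := fun x => rfl
  -- An inverse found in the larger integral closure is the inverse taken in `N`, and it is
  -- integral; so units descend, and locality descends with them.
  have : IsLocalHom (ψ : integralClosure O N →+* integralClosure O E) := by
    refine ⟨fun x hx => ?_⟩
    obtain ⟨y, hy⟩ := isUnit_iff_exists_inv.1 hx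
    have hy' : algebraMap N E x * (y : E) = 1 := congrArg Subtype.val hy
    have hx0 : (x : N) ≠ 0 := by
      rintro h0
      rw [h0, map_zero, zero_mul] at hy'
      exact zero_ne_one hy'
    have hyx : (y : E) = algebraMap N E (x : N)⁻¹ := by
      rw [map_inv₀]; exact eq_inv_of_mul_eq_one_right hy'
    have hint : IsIntegral O (x : N)⁻¹ := by
      rw [← isIntegral_algebraMap_iff (algebraMap N E).injective, ← hyx]; exact y.2
    exact isUnit_iff_exists_inv.2 ⟨⟨_, hint⟩, Subtype.ext (mul_inv_cancel₀ hx0)⟩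
  exact RingHom.domain_isLocalRing (ψ : integralClosure O N →+* integralClosure O E)

end IntegralClosureLocal

theorem Valuation.mem_maximalIdeal_valuationSubring {K Γ : Type*} [Field K]
    [LinearOrderedCommGroupWithZero Γ] (v : Valuation K Γ) (z : v.valuationSubring) :
    z ∈ maximalIdeal v.valuationSubring ↔ v z < 1 := by
  rw [IsLocalRing.mem_maximalIdeal, mem_nonunits_iff,
    (Valuation.valuationSubring.integers v).isUnit_iff_valuation_eq_one, lt_iff_le_and_ne]
  exact ⟨fun h => ⟨z.2, h⟩, fun h => h.2⟩

/-- Apply the hypothesis to `x⁻¹`: agreement of the valuation rings implies agreement of the maximal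
ideals, with no map between the value groups. -/
theorem Valuation.lt_one_iff_of_le_one_iff {K N Γ Γ' : Type*} [Field K] [Field N]
    [LinearOrderedCommGroupWithZero Γ] [LinearOrderedCommGroupWithZero Γ'] (v : Valuation K Γ)
    (w : Valuation N Γ') (φ : K →+* N) (h : ∀ x, w (φ x) ≤ 1 ↔ v x ≤ 1) (x : K) :
    w (φ x) < 1 ↔ v x < 1 := by
  by_cases hx : x = 0
  · simp [hx]
  have h2 := h x⁻¹
  rw [map_inv₀, map_inv₀, map_inv₀, inv_le_one₀ (zero_lt_iff.2 (v.ne_zero_iff.2 hx)),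
    inv_le_one₀ (zero_lt_iff.2 (w.ne_zero_iff.2 ((map_ne_zero φ).2 hx)))] at h2
  rw [← not_le, h2, not_le]

/-! ### Uniqueness of the extension of a henselian valuation -/

section IntegralOverHenselian

open Polynomial

/-- Let `B` be a local subring of a field, integrally closed in it. If `x` is a root of a polynomial
over `B` one of whose coefficients is a unit, then `x` or its inverse lies in `B`. -/
theorem mem_or_inv_mem_of_isUnit_coeff {N : Type*} [Field N] (B : Subring N) [IsLocalRing B]
    (hB : ∀ x : N, IsIntegral B x → x ∈ B) (x : N) (p : B[X]) (hp : aeval x p = 0)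
    (hu : ∃ i, IsUnit (p.coeff i)) : x ∈ B ∨ x⁻¹ ∈ B := by
  induction hn : p.natDegree using Nat.strong_induction_on generalizing p with
  | _ n ih =>
  obtain ⟨i, hi⟩ := hu
  have hp0 : p ≠ 0 := by rintro rfl; simp at hi
  have hbx : (p.leadingCoeff : N) * x ∈ B := hB _ (isIntegral_leadingCoeff_smul p x hp)
  set b : B := ⟨_, hbx⟩ with hb
  by_cases hlc : IsUnit p.leadingCoeff
  · left
    obtain ⟨c, hc⟩ := isUnit_iff_exists_inv.1 hlc
    have hc' : (p.leadingCoeff : N) * (c : N) = 1 := congrArg Subtype.val hc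
    have : x = (c : N) * (p.leadingCoeff * x) := by
      rw [← mul_assoc, mul_comm (c : N), hc', one_mul]
    rw [this]
    exact B.mul_mem c.2 hbx
  have hin : i ≠ n := by
    rintro rfl
    rw [← hn] at hi
    exact hlc hi
  have hi_le : i ≤ n := hn ▸ le_natDegree_of_ne_zero (by rintro h; simp [h] at hi)
  obtain ⟨m, rfl⟩ : ∃ m, n = m + 1 := ⟨n - 1, by omega⟩
  -- The leading term is absorbed into the next one, since lc · x^(m+1) = b · x^m with b = lc · x in
  -- `B`. This lowers the degree and changes only the coefficient of index `m`. If no unit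
  -- coefficient survives, that one was the unit, so `b` is itself a unit and x⁻¹ = lc · b⁻¹.
  set q := p.eraseLead + C b * X ^ m with hq
  have hqx : aeval x q = 0 := by
    rw [hq, ← hp]
    conv_rhs => rw [← eraseLead_add_C_mul_X_pow p]
    simp only [map_add, map_mul, aeval_C, aeval_X, map_pow, hn, pow_succ]
    change _ + ((p.leadingCoeff : N) * x) * x ^ m = _ + (p.leadingCoeff : N) * (x ^ m * x)
    ring
  have hqdeg : q.natDegree ≤ m := by
    refine natDegree_add_le_of_degree_le ?_ (natDegree_C_mul_X_pow_le _ _)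
    exact (eraseLead_natDegree_le p).trans (by omega)
  by_cases hqu : ∃ j, IsUnit (q.coeff j)
  · exact ih _ (by omega) q hqx hqu rfl
  push Not at hqu
  have hcoeff : ∀ j, j ≠ m + 1 → q.coeff j = p.coeff j + if j = m then b else 0 := by
    intro j hj
    rw [hq, coeff_add, eraseLead_coeff_of_ne _ (by rwa [hn]), coeff_C_mul_X_pow]
  have him : i = m := by
    by_contra h
    refine hqu i ?_
    rw [hcoeff i hin, if_neg h, add_zero]
    exact hi
  subst him
  have h1 := hqu i
  rw [hcoeff i hin, if_pos rfl] at h1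
  have hbu : IsUnit b := by
    by_contra hbn
    have h2 := (maximalIdeal B).sub_mem ((mem_maximalIdeal _).2 h1) ((mem_maximalIdeal _).2 hbn)
    rw [add_sub_cancel_right] at h2
    exact h2 hi
  right
  obtain ⟨c, hc⟩ := isUnit_iff_exists_inv.1 hbu
  have hc' : (p.leadingCoeff : N) * x * (c : N) = 1 := congrArg Subtype.val hc
  have : x⁻¹ = p.leadingCoeff * c := by
    refine inv_eq_of_mul_eq_one_right ?_
    rw [← hc']; ring
  rw [this]
  exact B.mul_mem (p.leadingCoeff).2 c.2

/-- An algebraic element over a valued field is a root of a polynomial with coefficients in the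
valuation ring, one of which is `1`. -/
theorem Valuation.exists_aeval_eq_zero_isUnit_coeff {K N Γ : Type*} [Field K] [Field N]
    [Algebra K N] [LinearOrderedCommGroupWithZero Γ] (v : Valuation K Γ) (x : N)
    (hx : IsAlgebraic K x) :
    ∃ p : v.valuationSubring[X], aeval x p = 0 ∧ ∃ i, p.coeff i = 1 := by
  obtain ⟨p, hp0, hpx⟩ := hx
  -- Dividing by a coefficient of largest value makes all coefficients integral and that one equal
  -- to 1.
  obtain ⟨i, hi, hmax⟩ := p.support.exists_max_image (fun i => v (p.coeff i))
    (by simpa using hp0)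
  have hci : p.coeff i ≠ 0 := mem_support_iff.1 hi
  have hle : ∀ j, v ((C (p.coeff i)⁻¹ * p).coeff j) ≤ 1 := by
    intro j
    rw [coeff_C_mul, map_mul, map_inv₀]
    by_cases hj : j ∈ p.support
    · have := hmax j hj
      calc (v (p.coeff i))⁻¹ * v (p.coeff j) ≤ (v (p.coeff i))⁻¹ * v (p.coeff i) := by gcongr
        _ = 1 := inv_mul_cancel₀ ((v.ne_zero_iff).2 hci)
    · rw [notMem_support_iff.1 hj]; simp
  have hlift : C (p.coeff i)⁻¹ * p ∈ lifts (algebraMap v.valuationSubring K) := by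
    rw [lifts_iff_coeff_lifts]
    intro j
    exact ⟨⟨_, hle j⟩, rfl⟩
  obtain ⟨q, hq⟩ := (mem_lifts _).1 hlift
  refine ⟨q, ?_, i, ?_⟩
  · rw [← aeval_map_algebraMap K, hq, map_mul, hpx, mul_zero]
  · apply Subtype.val_injective
    have : algebraMap v.valuationSubring K (q.coeff i) = (C (p.coeff i)⁻¹ * p).coeff i := by
      rw [← hq, coeff_map]
    rw [coeff_C_mul, inv_mul_cancel₀ hci] at this
    exact this

variable {K N Γ : Type*} [Field K] [Field N] [Algebra K N] [LinearOrderedCommGroupWithZero Γ]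

/-- Over a henselian valued field, the integral closure of the valuation ring in a finite
extension is a valuation ring. -/
theorem isIntegral_or_isIntegral_inv_of_henselian [FiniteDimensional K N] (v : Valuation K Γ)
    [HenselianLocalRing v.valuationSubring] (x : N) :
    IsIntegral v.valuationSubring x ∨ IsIntegral v.valuationSubring x⁻¹ := by
  have hloc := isLocalRing_integralClosure (O := v.valuationSubring) (K := K) (N := N)
  have : IsLocalRing (integralClosure v.valuationSubring N).toSubring := hloc
  obtain ⟨p, hp, i, hi⟩ := v.exists_aeval_eq_zero_isUnit_coeff x
    (Algebra.IsAlgebraic.isAlgebraic (R := K) x)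
  refine mem_or_inv_mem_of_isUnit_coeff (integralClosure v.valuationSubring N).toSubring ?_ x
    (p.map (algebraMap v.valuationSubring (integralClosure v.valuationSubring N))) ?_ ⟨i, ?_⟩
  · intro y hy
    exact isIntegral_trans (A := integralClosure v.valuationSubring N) y hy
  · have := aeval_map_algebraMap (integralClosure v.valuationSubring N) x p
    exact this.trans hp
  · rw [coeff_map, hi, map_one]
    exact isUnit_one

/-- The valuation ring of an extension of a henselian valuation to a finite extension is the
integral closure. -/
theorem Valuation.le_one_iff_isIntegral_of_henselian {Γ' : Type*}
    [LinearOrderedCommGroupWithZero Γ'] [FiniteDimensional K N] (v : Valuation K Γ)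
    [HenselianLocalRing v.valuationSubring] (w : Valuation N Γ')
    (hw : ∀ x, w (algebraMap K N x) ≤ 1 ↔ v x ≤ 1) (x : N) :
    w x ≤ 1 ↔ IsIntegral v.valuationSubring x := by
  have hle : ∀ y : N, IsIntegral v.valuationSubring y → w y ≤ 1 := by
    intro y hy
    let φ : v.valuationSubring →+* w.valuationSubring :=
      ((algebraMap K N).comp (algebraMap v.valuationSubring K)).codRestrict
        w.valuationSubring.toSubring fun z => (hw z).2 z.2
    obtain ⟨p, hpm, hp⟩ := hy
    have hint : IsIntegral w.valuationSubring y := by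
      refine ⟨p.map φ, hpm.map φ, ?_⟩
      rw [eval₂_map]
      exact hp
    obtain ⟨z, hz⟩ := IsIntegrallyClosed.isIntegral_iff.1 hint
    rw [← hz]
    exact z.2
  refine ⟨fun hx => ?_, hle x⟩
  by_contra hxn
  have hx0 : x ≠ 0 := by rintro rfl; exact hxn isIntegral_zero
  have hinv := (isIntegral_or_isIntegral_inv_of_henselian v x).resolve_left hxn
  have hloc := isLocalRing_integralClosure (O := v.valuationSubring) (K := K) (N := N)
  let ψ : integralClosure v.valuationSubring N →+* w.valuationSubring :=
    (algebraMap (integralClosure v.valuationSubring N) N).codRestrict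
      w.valuationSubring.toSubring fun z => hle z z.2
  -- The pullback is a prime lying over the maximal ideal downstairs, hence maximal by integrality.
  -- So if the integral element `x⁻¹` is not a unit, then w(x⁻¹) < 1, against w(x) ≤ 1; if it is a
  -- unit, `x` is integral.
  have hP : (maximalIdeal w.valuationSubring).comap ψ =
      maximalIdeal (integralClosure v.valuationSubring N) := by
    have hprime : ((maximalIdeal w.valuationSubring).comap ψ).IsPrime := inferInstance
    refine IsLocalRing.eq_maximalIdeal
      (Ideal.isMaximal_of_isIntegral_of_isMaximal_comap (R := v.valuationSubring) _ ?_)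
    have : ((maximalIdeal w.valuationSubring).comap ψ).comap
        (algebraMap v.valuationSubring (integralClosure v.valuationSubring N)) =
        maximalIdeal v.valuationSubring := by
      refine le_antisymm (IsLocalRing.le_maximalIdeal ?_) fun z hz => ?_
      · exact (Ideal.IsPrime.comap _).ne_top
      · rw [Ideal.mem_comap, Ideal.mem_comap, Valuation.mem_maximalIdeal_valuationSubring]
        rw [Valuation.mem_maximalIdeal_valuationSubring] at hz
        exact (Valuation.lt_one_iff_of_le_one_iff v w (algebraMap K N) hw z).2 hz
    rw [this]
    infer_instance
  set y : integralClosure v.valuationSubring N := ⟨x⁻¹, hinv⟩ with hy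
  by_cases hyu : IsUnit y
  · obtain ⟨z, hz⟩ := isUnit_iff_exists_inv.1 hyu
    have hz' : x⁻¹ * (z : N) = 1 := congrArg Subtype.val hz
    have : (z : N) = x := by
      rw [← mul_right_inj' (inv_ne_zero hx0), hz', inv_mul_cancel₀ hx0]
    exact hxn (this ▸ z.2)
  · have hym : y ∈ (maximalIdeal w.valuationSubring).comap ψ := by
      rw [hP]; exact hyu
    rw [Ideal.mem_comap, Valuation.mem_maximalIdeal_valuationSubring] at hym
    have hym' : w x⁻¹ < 1 := hym
    rw [map_inv₀] at hym'
    exact hym'.not_ge ((one_le_inv₀ (zero_lt_iff.2 (w.ne_zero_iff.2 hx0))).2 hx)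

end IntegralOverHenselian

/-! ### Polynomials with integral coefficients -/

section ValuationPolynomial

open Polynomial

variable {L Γ : Type*} [Field L] [LinearOrderedCommGroupWithZero Γ] (v : Valuation L Γ)

theorem Valuation.exists_map_algebraMap_eq (P : L[X]) (hP : ∀ i, v (P.coeff i) ≤ 1) :
    ∃ Q : v.valuationSubring[X], Q.map (algebraMap v.valuationSubring L) = P := by
  have : P ∈ lifts (algebraMap v.valuationSubring L) := by
    rw [lifts_iff_coeff_lifts]
    exact fun i => ⟨⟨_, hP i⟩, rfl⟩
  exact (mem_lifts _).1 this

theorem Valuation.derivative_coeff_le_one {P : L[X]} (hP : ∀ i, v (P.coeff i) ≤ 1) (i : ℕ) :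
    v (P.derivative.coeff i) ≤ 1 := by
  obtain ⟨Q, rfl⟩ := v.exists_map_algebraMap_eq P hP
  rw [derivative_map, coeff_map]
  exact (Q.derivative.coeff i).2

theorem Valuation.eval_sub_eval_lt_one {P : L[X]} (hP : ∀ i, v (P.coeff i) ≤ 1) {x y : L}
    (hx : v x ≤ 1) (hy : v y ≤ 1) (hxy : v (x - y) < 1) : v (P.eval x - P.eval y) < 1 := by
  obtain ⟨Q, rfl⟩ := v.exists_map_algebraMap_eq P hP
  obtain ⟨c, hc⟩ := Q.sub_dvd_eval_sub (⟨x, hx⟩ : v.valuationSubring) ⟨y, hy⟩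
  have hc' : (Q.map (algebraMap v.valuationSubring L)).eval x -
      (Q.map (algebraMap v.valuationSubring L)).eval y = (x - y) * c := by
    have h := congrArg (algebraMap v.valuationSubring L) hc
    rwa [_root_.map_sub, ← eval_map_apply, ← eval_map_apply, map_mul, _root_.map_sub] at h
  rw [hc', map_mul]
  exact mul_lt_one_of_lt_of_le hxy c.2

theorem Valuation.eq_one_of_sub_lt_one {x y : L} (hx : v x = 1) (hxy : v (y - x) < 1) :
    v y = 1 := by
  rw [← sub_add_cancel y x, v.map_add_eq_of_lt_right (x := y - x) (y := x) (by rwa [hx])]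
  exact hx

theorem Valuation.sub_lt_one {x y : L} (hx : v x < 1) (hy : v y < 1) : v (x - y) < 1 :=
  (v.map_sub x y).trans_lt (max_lt hx hy)

/-- Two integral roots with the same residue coincide if the residue is a simple root of the
reduction. -/
theorem Valuation.root_unique {P : L[X]} (hP : ∀ i, v (P.coeff i) ≤ 1) {x y : L}
    (hx : v x ≤ 1) (hy : v y ≤ 1) (hxy : v (x - y) < 1) (hPx : P.eval x = 0) (hPy : P.eval y = 0)
    (hd : v (P.derivative.eval x) = 1) : x = y := by
  obtain ⟨Q, rfl⟩ := v.exists_map_algebraMap_eq P hP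
  rw [derivative_map] at hd
  have e : ∀ (R : v.valuationSubring[X]) (z : v.valuationSubring),
    (R.map (algebraMap v.valuationSubring L)).eval (z : L) = R.eval z :=
    fun R z => eval_map_apply (algebraMap v.valuationSubring L) z
  have h := IsLocalRing.eq_of_eval_eq_zero_of_not_isUnit_sub (f := Q)
    (a := (⟨x, hx⟩ : v.valuationSubring)) (b := ⟨y, hy⟩)
    (Subtype.ext ((e Q ⟨x, hx⟩).symm.trans hPx)) (Subtype.ext ((e Q ⟨y, hy⟩).symm.trans hPy))
    ((mem_maximalIdeal _).1 ((v.mem_maximalIdeal_valuationSubring _).2 hxy))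
    ((Valuation.valuationSubring.integers v).isUnit_iff_valuation_eq_one.2
      ((congrArg v (e _ ⟨x, hx⟩).symm).trans hd))
  exact congrArg Subtype.val h

theorem Valuation.le_one_of_root {P : L[X]} (hm : P.Monic) (hP : ∀ i, v (P.coeff i) ≤ 1) {x : L}
    (hx : P.eval x = 0) : v x ≤ 1 := by
  obtain ⟨Q, rfl⟩ := v.exists_map_algebraMap_eq P hP
  have hint : IsIntegral v.valuationSubring x := by
    refine ⟨Q, ?_, by rwa [eval₂_eq_eval_map]⟩
    exact (Function.Injective.monic_map_iff Subtype.val_injective).2 hm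
  obtain ⟨z, hz⟩ := IsIntegrallyClosed.isIntegral_iff.1 hint
  rw [← hz]
  exact z.2

end ValuationPolynomial

/-! ### Hensel's lemma in finite extensions -/

section HenselianExtension

open Polynomial

variable {K F N Γ Γ' : Type*} [Field K] [Field F] [Field N] [Algebra K F] [Algebra K N]
  [Algebra F N] [IsScalarTower K F N] [LinearOrderedCommGroupWithZero Γ]
  [LinearOrderedCommGroupWithZero Γ']

/-- Some root `r` of `P` in `N` is congruent to `a`. The valuation ring of `N` is the integral
closure, so automorphisms over `F` preserve it and send `r` to another root congruent to `a`. Such a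
root is unique, so `r` is fixed; being also separable over `F`, it lies in `F`. -/
theorem exists_root_of_henselian_of_splits [FiniteDimensional K N] [Normal K N]
    (v : Valuation K Γ) [HenselianLocalRing v.valuationSubring] (w : Valuation F Γ')
    (hw : ∀ x, w (algebraMap K F x) ≤ 1 ↔ v x ≤ 1) (P : F[X]) (hm : P.Monic)
    (hP : ∀ i, w (P.coeff i) ≤ 1) (hs : (P.map (algebraMap F N)).Splits) (a : F)
    (ha : w a ≤ 1) (h0 : w (P.eval a) < 1) (h1 : w (P.derivative.eval a) = 1) :
    ∃ b, P.eval b = 0 ∧ w (b - a) < 1 := by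
  classical
  have : FiniteDimensional K F := FiniteDimensional.of_injective
    (IsScalarTower.toAlgHom K F N).toLinearMap (algebraMap F N).injective
  have : Normal F N := Normal.tower_top_of_normal K F N
  let W : ValuationSubring N := ValuationSubring.ofSubring
    (integralClosure v.valuationSubring N).toSubring
    (isIntegral_or_isIntegral_inv_of_henselian v)
  set u := W.valuation with hu_def
  have hu : ∀ y, u y ≤ 1 ↔ IsIntegral v.valuationSubring y := fun y =>
    W.valuation_le_one_iff y
  have hwu : ∀ x, u (algebraMap F N x) ≤ 1 ↔ w x ≤ 1 := by
    intro x
    rw [hu, v.le_one_iff_isIntegral_of_henselian w hw]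
    exact isIntegral_algebraMap_iff (algebraMap F N).injective
  have hwu' := Valuation.lt_one_iff_of_le_one_iff w u (algebraMap F N) hwu
  have hσu : ∀ (σ : N ≃ₐ[F] N) y, u (σ y) < 1 ↔ u y < 1 := by
    intro σ
    refine Valuation.lt_one_iff_of_le_one_iff u u (σ : N →+* N) fun y => ?_
    rw [hu, hu]
    exact isIntegral_algHom_iff ((σ.restrictScalars K).restrictScalars v.valuationSubring).toAlgHom
      σ.injective
  set Q := P.map (algebraMap F N) with hQ
  have hQm : Q.Monic := hm.map _
  have hQc : ∀ i, u (Q.coeff i) ≤ 1 := fun i => by rw [hQ, coeff_map, hwu]; exact hP i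
  set α := algebraMap F N a with hα
  have hα1 : u α ≤ 1 := (hwu a).2 ha
  have hQα : u (Q.eval α) < 1 := by
    rw [hQ, hα, eval_map_apply, hwu']; exact h0
  have hQ'α : u (Q.derivative.eval α) = 1 := by
    rw [hQ, hα, derivative_map, eval_map_apply]
    exact le_antisymm ((hwu _).2 h1.le) (not_lt.1 fun h => ((hwu' _).1 h).ne h1)
  -- Q(α) is the product of the differences α - r, and a product of factors of value at least 1
  -- cannot have value below 1.
  obtain ⟨r, hr, hrα⟩ : ∃ r ∈ Q.roots, u (α - r) < 1 := by
    by_contra! hcon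
    have hprod := hs.eq_prod_roots
    rw [hQm.leadingCoeff, C_1, one_mul] at hprod
    rw [hprod, eval_multiset_prod, Multiset.map_map, map_multiset_prod, Multiset.map_map] at hQα
    refine hQα.not_ge (Multiset.one_le_prod_of_one_le fun x hx => ?_)
    obtain ⟨r, hr, rfl⟩ := Multiset.mem_map.1 hx
    simpa using hcon r hr
  have hr0 : Q.eval r = 0 := (mem_roots hQm.ne_zero).1 hr
  have hr1 : u r ≤ 1 := u.le_one_of_root hQm hQc hr0
  have hQ'r : u (Q.derivative.eval r) = 1 :=
    u.eq_one_of_sub_lt_one hQ'α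
      (u.eval_sub_eval_lt_one (u.derivative_coeff_le_one hQc) hr1 hα1 (by rwa [u.map_sub_swap]))
  have hfix : ∀ σ : N ≃ₐ[F] N, σ r = r := by
    intro σ
    have hσα : σ α = α := σ.commutes a
    have hσr0 : Q.eval (σ r) = 0 := by
      have h := hr0
      rw [hQ, eval_map_algebraMap] at h ⊢
      rw [← AlgEquiv.coe_toAlgHom, aeval_algHom_apply, h, map_zero]
    refine (u.root_unique hQc hr1 (u.le_one_of_root hQm hQc hσr0) ?_ hr0 hσr0 hQ'r).symm
    have h2 : u (α - σ r) < 1 := by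
      rw [← hσα, ← map_sub, hσu]; exact hrα
    rw [show r - σ r = (α - σ r) - (α - r) by ring]
    exact u.sub_lt_one h2 hrα
  have hralg : IsIntegral F r := IsIntegral.tower_top (R := K) (Algebra.IsIntegral.isIntegral r)
  -- `N/F` is only normal, so being fixed is not enough to lie in `F`. An inseparable minimal
  -- polynomial has zero derivative, which would make P'(r) vanish.
  have hsep : (minpoly F r).Separable := by
    rw [separable_iff_derivative_ne_zero (minpoly.irreducible hralg)]
    intro hd
    obtain ⟨R, hR⟩ := minpoly.dvd F r (p := P) (by rw [← eval_map_algebraMap]; exact hr0)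
    have : Q.derivative.eval r = 0 := by
      rw [hQ, derivative_map, eval_map_algebraMap, hR, derivative_mul, hd]
      simp
    rw [this, map_zero] at hQ'r
    exact zero_ne_one hQ'r
  have hrange : r ∈ (algebraMap F N).range := by
    have hspl : ((minpoly F r).map (algebraMap F N)).Splits := Normal.splits inferInstance r
    have hne : (minpoly F r).map (algebraMap F N) ≠ 0 :=
      ((minpoly.monic hralg).map (algebraMap F N)).ne_zero
    have hsub : ((minpoly F r).map (algebraMap F N)).roots.toFinset ⊆ {r} := by
      intro s hs
      rw [Multiset.mem_toFinset, mem_roots hne, IsRoot, eval_map_algebraMap] at hs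
      obtain ⟨σ, hσ⟩ := minpoly.exists_algEquiv_of_root' hralg.isAlgebraic hs
      rw [Finset.mem_singleton, ← hσ, hfix]
    have hcard := Finset.card_le_card hsub
    rw [Multiset.toFinset_card_of_nodup (nodup_roots (Separable.map hsep)),
      ← hspl.natDegree_eq_card_roots, natDegree_map, Finset.card_singleton] at hcard
    refine minpoly.mem_range_of_degree_eq_one F r ?_
    rw [degree_eq_natDegree (minpoly.ne_zero hralg)]
    have := minpoly.natDegree_pos hralg
    norm_cast
    omega
  obtain ⟨b, hb⟩ := hrange
  refine ⟨b, (algebraMap F N).injective ?_, ?_⟩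
  · rw [← eval_map_apply, hb, map_zero]; exact hr0
  · rw [← hwu', map_sub, hb, u.map_sub_swap]; exact hrα

/-- A finite extension of a henselian valued field is henselian. -/
theorem exists_root_of_henselian [FiniteDimensional K F]
    (v : Valuation K Γ) [HenselianLocalRing v.valuationSubring] (w : Valuation F Γ')
    (hw : ∀ x, w (algebraMap K F x) ≤ 1 ↔ v x ≤ 1) (P : F[X]) (hm : P.Monic)
    (hP : ∀ i, w (P.coeff i) ≤ 1) (a : F)
    (ha : w a ≤ 1) (h0 : w (P.eval a) < 1) (h1 : w (P.derivative.eval a) = 1) :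
    ∃ b, P.eval b = 0 ∧ w (b - a) < 1 := by
  let S := P.SplittingField
  have : FiniteDimensional K S := FiniteDimensional.trans K F S
  -- Normality is wanted over `K`, where the henselian hypothesis lives, so the splitting field of
  -- `P` over `F` is enlarged.
  let N := IntermediateField.normalClosure K S (AlgebraicClosure S)
  let _ : Algebra F N := ((algebraMap S N).comp (algebraMap F S)).toAlgebra
  have : IsScalarTower K F N := IsScalarTower.of_algebraMap_eq fun x => by
    rw [RingHom.algebraMap_toAlgebra, RingHom.comp_apply, ← IsScalarTower.algebraMap_apply K F S,
      ← IsScalarTower.algebraMap_apply K S N]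
  refine exists_root_of_henselian_of_splits (N := N) v w hw P hm hP ?_ a ha h0 h1
  rw [RingHom.algebraMap_toAlgebra, ← Polynomial.map_map]
  exact (SplittingField.splits P).map _

end HenselianExtension

/-! ### Value groups and residue fields of subfields; the fundamental inequality -/

section SubfieldInvariants

variable {L Γ : Type*} [Field L] [LinearOrderedCommGroupWithZero Γ] (v : Valuation L Γ)

/-- The value group of a subfield. -/
def valueSubgroup (F : Subfield L) : Subgroup Γˣ where
  carrier := {γ | ∃ x ∈ F, v x = γ}
  one_mem' := ⟨1, F.one_mem, by simp⟩
  mul_mem' := by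
    rintro _ _ ⟨x, hx, hx'⟩ ⟨y, hy, hy'⟩
    exact ⟨x * y, F.mul_mem hx hy, by simp [hx', hy']⟩
  inv_mem' := by
    rintro _ ⟨x, hx, hx'⟩
    exact ⟨x⁻¹, F.inv_mem hx, by simp [hx']⟩

theorem mem_valueSubgroup {F : Subfield L} {γ : Γˣ} :
    γ ∈ valueSubgroup v F ↔ ∃ x ∈ F, v x = γ := Iff.rfl

theorem valueSubgroup_mono {A B : Subfield L} (h : A ≤ B) :
    valueSubgroup v A ≤ valueSubgroup v B :=
  fun _ ⟨x, hx, hx'⟩ => ⟨x, h hx, hx'⟩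

/-- The residue field of a subfield, inside the residue field of the whole field. -/
def residueSubfield (F : Subfield L) : Subfield (ResField v) where
  carrier := {ξ | ∃ x : v.valuationSubring, (x : L) ∈ F ∧ residue v.valuationSubring x = ξ}
  one_mem' := ⟨1, F.one_mem, map_one _⟩
  zero_mem' := ⟨0, F.zero_mem, map_zero _⟩
  mul_mem' := by
    rintro _ _ ⟨x, hx, rfl⟩ ⟨y, hy, rfl⟩
    exact ⟨x * y, F.mul_mem hx hy, map_mul _ _ _⟩
  add_mem' := by
    rintro _ _ ⟨x, hx, rfl⟩ ⟨y, hy, rfl⟩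
    exact ⟨x + y, F.add_mem hx hy, map_add _ _ _⟩
  neg_mem' := by
    rintro _ ⟨x, hx, rfl⟩
    exact ⟨-x, F.neg_mem hx, map_neg _ _⟩
  inv_mem' := by
    rintro _ ⟨x, hx, rfl⟩
    by_cases hu : IsUnit x
    · obtain ⟨y, hy⟩ := isUnit_iff_exists_inv.1 hu
      refine ⟨y, ?_, ?_⟩
      · have : (x : L) * y = 1 := congrArg Subtype.val hy
        rw [eq_inv_of_mul_eq_one_right this]
        exact F.inv_mem hx
      · rw [eq_comm, inv_eq_of_mul_eq_one_right]
        rw [← map_mul, hy, map_one]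
    · refine ⟨0, F.zero_mem, ?_⟩
      rw [(residue_eq_zero_iff x).2 ((mem_maximalIdeal x).2 hu), inv_zero, map_zero]

theorem mem_residueSubfield {F : Subfield L} {ξ : ResField v} :
    ξ ∈ residueSubfield v F ↔
      ∃ x : v.valuationSubring, (x : L) ∈ F ∧ residue v.valuationSubring x = ξ := Iff.rfl

theorem residueSubfield_mono {A B : Subfield L} (h : A ≤ B) :
    residueSubfield v A ≤ residueSubfield v B :=
  fun _ ⟨x, hx, hx'⟩ => ⟨x, h hx, hx'⟩

theorem Valuation.residue_eq_zero {x : v.valuationSubring} :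
    residue v.valuationSubring x = 0 ↔ v x < 1 := by
  rw [residue_eq_zero_iff, v.mem_maximalIdeal_valuationSubring]

/-- Products of elements with linearly independent residues and elements with values in distinct
cosets are linearly independent. -/
theorem linearIndependent_mul_of_residue (A : Subfield L) {ι J : Type*}
    (u : ι → v.valuationSubring)
    (hu : LinearIndependent (residueSubfield v A) fun i => residue v.valuationSubring (u i))
    (a : J → L) (ha : ∀ j, a j ≠ 0)
    (haJ : ∀ i j, (∃ x ∈ A, v x * v (a i) = v (a j)) → i = j) :
    LinearIndependent A fun p : ι × J => (u p.1 : L) * a p.2 := by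
  classical
  rw [linearIndependent_iff']
  intro s g hg
  by_contra! hcon
  obtain ⟨p₀, hp₀, hgp₀⟩ := hcon
  -- Divide the relation by a term coefficient `d` of largest value and reduce. Terms from other
  -- cosets have residue zero, since equality of values would identify the cosets. What remains is a
  -- relation over the residue field of `A` in which the coefficient at `p₁` is 1.
  obtain ⟨p₁, hp₁, hmax⟩ := s.exists_max_image (fun p => v (g p * a p.2)) ⟨p₀, hp₀⟩
  have hd0 : (g p₁ : L) * a p₁.2 ≠ 0 := by
    intro h0
    have h := hmax p₀ hp₀
    rw [h0, map_zero, le_zero_iff, v.zero_iff] at h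
    exact (mul_ne_zero (by simpa using hgp₀) (ha _)) h
  have hg1 : (g p₁ : L) ≠ 0 := left_ne_zero_of_mul hd0
  set d := (g p₁ : L) * a p₁.2 with hd
  have hvd : 0 < v d := zero_lt_iff.2 (v.ne_zero_iff.2 hd0)
  have hle : ∀ p ∈ s, v (g p * a p.2 / d) ≤ 1 := fun p hp => by
    rw [map_div₀]; exact (div_le_one₀ hvd).2 (hmax p hp)
  let c : ι × J → v.valuationSubring := fun p =>
    if hp : p ∈ s then ⟨g p * a p.2 / d, hle p hp⟩ else 0
  have hc : ∀ p ∈ s, (c p : L) = g p * a p.2 / d := fun p hp => by simp [c, hp]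
  have hsum : ∑ p ∈ s, c p * u p.1 = 0 := by
    apply Subtype.val_injective
    have : ((∑ p ∈ s, c p * u p.1 : v.valuationSubring) : L) =
        (∑ p ∈ s, g p • ((u p.1 : L) * a p.2)) / d := by
      rw [Finset.sum_div]
      change v.valuationSubring.subtype _ = _
      rw [map_sum]
      refine Finset.sum_congr rfl fun p hp => ?_
      change (c p : L) * u p.1 = _
      rw [hc p hp, Subfield.smul_def, smul_eq_mul]
      ring
    rw [this, hg, zero_div]
    rfl
  have hres : ∀ p ∈ s, p.2 ≠ p₁.2 → residue v.valuationSubring (c p) = 0 := by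
    intro p hp hne
    rw [v.residue_eq_zero, hc p hp]
    refine lt_of_le_of_ne (hle p hp) fun h1 => hne.symm (haJ _ _ ?_)
    rw [map_div₀, div_eq_one_iff_eq hvd.ne', hd, map_mul, map_mul] at h1
    have hgp : (g p : L) ≠ 0 := by
      intro h0
      rw [h0, map_zero, zero_mul, eq_comm, mul_eq_zero, v.zero_iff, v.zero_iff] at h1
      exact h1.elim hg1 (ha _)
    refine ⟨(g p : L)⁻¹ * g p₁, A.mul_mem (A.inv_mem (g p).2) (g p₁).2, ?_⟩
    rw [map_mul, map_inv₀, mul_assoc, ← h1, ← mul_assoc,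
      inv_mul_cancel₀ (v.ne_zero_iff.2 hgp), one_mul]
  have hcA : ∀ i, (i, p₁.2) ∈ s → (c (i, p₁.2) : L) ∈ A := by
    intro i hi
    rw [hc _ hi, hd, mul_div_mul_right _ _ (ha _)]
    exact A.div_mem (g _).2 (g _).2
  let t := (s.filter fun p => p.2 = p₁.2).image Prod.fst
  have ht : ∀ i, i ∈ t ↔ (i, p₁.2) ∈ s := by
    intro i
    simp only [t, Finset.mem_image, Finset.mem_filter]
    constructor
    · rintro ⟨⟨i', j'⟩, ⟨h1, h2⟩, h3⟩
      simp only at h2 h3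
      rwa [← h2, ← h3]
    · exact fun h => ⟨_, ⟨h, rfl⟩, rfl⟩
  let r : ι → residueSubfield v A := fun i =>
    if hi : (i, p₁.2) ∈ s then ⟨residue _ (c (i, p₁.2)), ⟨_, hcA i hi, rfl⟩⟩ else 0
  have hr : ∀ i ∈ t, (r i : ResField v) = residue _ (c (i, p₁.2)) := fun i hi => by
    simp [r, (ht i).1 hi]
  have hzero : ∑ i ∈ t, r i • residue v.valuationSubring (u i) = 0 := by
    have h := congrArg (residue v.valuationSubring) hsum
    rw [map_sum, map_zero, ← Finset.sum_filter_add_sum_filter_not s fun p => p.2 = p₁.2,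
      Finset.sum_eq_zero (s := s.filter fun p => ¬ p.2 = p₁.2), add_zero] at h
    · rw [← h, Finset.sum_image]
      · refine Finset.sum_congr rfl fun p hp => ?_
        have hp' := Finset.mem_filter.1 hp
        have hpt : p.1 ∈ t := Finset.mem_image_of_mem _ hp
        rw [Subfield.smul_def, smul_eq_mul, hr _ hpt, map_mul, ← hp'.2]
      · intro p hp q hq hpq
        have hp' := (Finset.mem_filter.1 hp).2
        have hq' := (Finset.mem_filter.1 hq).2
        exact Prod.ext hpq (hp'.trans hq'.symm)
    · intro p hp
      have hp' := Finset.mem_filter.1 hp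
      rw [map_mul, hres p hp'.1 hp'.2, zero_mul]
  have h1 := linearIndependent_iff'.1 hu t r hzero p₁.1 ((ht _).2 hp₁)
  have h2 : residue v.valuationSubring (c p₁) = 0 := by
    rw [← hr p₁.1 ((ht _).2 hp₁), h1]
    rfl
  rw [v.residue_eq_zero, hc p₁ hp₁, ← hd, div_self hd0, map_one] at h2
  exact lt_irrefl _ h2

/-- The fundamental inequality `e f ≤ n`, with `e` and `f` finite. -/
theorem relIndex_mul_relfinrank_le {A B : Subfield L} (h : A ≤ B) (hn : A.relfinrank B ≠ 0) :
    (valueSubgroup v A).relIndex (valueSubgroup v B) *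
        (residueSubfield v A).relfinrank (residueSubfield v B) ≤ A.relfinrank B ∧
      (valueSubgroup v A).relIndex (valueSubgroup v B) ≠ 0 ∧
      (residueSubfield v A).relfinrank (residueSubfield v B) ≠ 0 := by
  classical
  have hR := residueSubfield_mono v h
  rw [Subfield.relfinrank_eq_finrank_of_le hR]
  rw [Subfield.relfinrank_eq_finrank_of_le h] at hn ⊢
  have : FiniteDimensional A (Subfield.extendScalars h) := FiniteDimensional.of_finrank_pos
    (Nat.pos_of_ne_zero hn)
  let b := Module.Free.chooseBasis (residueSubfield v A) (Subfield.extendScalars hR)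
  let ι := Module.Free.ChooseBasisIndex (residueSubfield v A) (Subfield.extendScalars hR)
  let J := valueSubgroup v B ⧸ (valueSubgroup v A).subgroupOf (valueSubgroup v B)
  have hb : ∀ i : ι, ∃ x : v.valuationSubring, (x : L) ∈ B ∧
    residue v.valuationSubring x = (b i : ResField v) := fun i => (b i).2
  choose u huB hu using hb
  have hJ : ∀ j : J, ∃ x ∈ B, v x = (j.out : Γˣ) := fun j => j.out.2
  choose a haB ha using hJ
  have hli : LinearIndependent A fun p : ι × J => (u p.1 : L) * a p.2 := by
    refine linearIndependent_mul_of_residue v A u ?_ a ?_ ?_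
    · simp only [hu]
      exact b.linearIndependent.map' (Subfield.extendScalars hR).val.toLinearMap
        (LinearMap.ker_eq_bot.2 Subtype.val_injective)
    · intro j
      rw [← v.ne_zero_iff, ha]
      exact Units.ne_zero _
    · rintro i j ⟨x, hx, hxij⟩
      rw [ha, ha] at hxij
      rw [← Quotient.out_eq' i, ← Quotient.out_eq' j]
      refine QuotientGroup.eq.2 ?_
      rw [Subgroup.mem_subgroupOf]
      refine ⟨x, hx, ?_⟩
      simp only [Subgroup.coe_mul, Subgroup.coe_inv, Units.val_mul, Units.val_inv_eq_inv_val]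
      rw [← hxij, mul_comm, mul_assoc, mul_inv_cancel₀ (Units.ne_zero _), mul_one]
  have hli' : LinearIndependent A fun p : ι × J =>
      (⟨(u p.1 : L) * a p.2, B.mul_mem (huB _) (haB _)⟩ : Subfield.extendScalars h) :=
    LinearIndependent.of_comp (Subfield.extendScalars h).val.toLinearMap hli
  -- Finiteness of both e and f is a conclusion: each factor of a finite product is finite because
  -- the other is nonempty.
  have hfin : Finite (ι × J) := hli'.finite
  have : Nonempty ι := b.index_nonempty
  have : Finite ι := Finite.prod_left J
  have : Finite J := Finite.prod_right ι
  have hcard : Nat.card (ι × J) ≤ Module.finrank A (Subfield.extendScalars h) := by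
    have := Fintype.ofFinite (ι × J)
    rw [Nat.card_eq_fintype_card]
    exact hli'.fintype_card_le_finrank
  rw [Nat.card_prod] at hcard
  have hι : Module.finrank (residueSubfield v A) (Subfield.extendScalars hR) = Nat.card ι :=
    Module.finrank_eq_nat_card_basis b
  rw [hι, mul_comm]
  exact ⟨hcard, Nat.card_ne_zero.2 ⟨inferInstance, ‹_›⟩, Nat.card_ne_zero.2 ⟨inferInstance, ‹_›⟩⟩

end SubfieldInvariants

/-! ### Tame extensions of subfields and towers -/

section TameSubfields

variable {L Γ : Type*} [Field L] [LinearOrderedCommGroupWithZero Γ] (v : Valuation L Γ)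

/-- Finite tame extensions of subfields of a valued field. -/
structure TameSubfield (A B : Subfield L) : Prop where
  le : A ≤ B
  finrank_ne_zero : A.relfinrank B ≠ 0
  coprime : (ringExpChar (ResField v)).Coprime ((valueSubgroup v A).relIndex (valueSubgroup v B))
  separable : ∀ ξ ∈ residueSubfield v B, IsSeparable (residueSubfield v A) ξ
  defectless : A.relfinrank B = (valueSubgroup v A).relIndex (valueSubgroup v B) *
    (residueSubfield v A).relfinrank (residueSubfield v B)

variable {v}

theorem IntermediateField.isSeparable_of_forall_mem {F k : Type*} [Field F] [Field k] [Algebra F k]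
    (E : IntermediateField F k) (hE : ∀ x ∈ E, IsSeparable F x) {x : k} (hx : IsSeparable E x) :
    IsSeparable F x := by
  have : Algebra.IsSeparable F E :=
    ⟨fun y => (isSeparable_map_iff E.val Subtype.val_injective).1 (hE y y.2)⟩
  exact IsSeparable.of_algebra_isSeparable_of_isSeparable F hx

theorem IntermediateField.isSeparable_of_mem_adjoin_simple {F k : Type*} [Field F] [Field k]
    [Algebra F k] {ξ η : k} (hξ : IsSeparable F ξ) (hη : η ∈ IntermediateField.adjoin F {ξ}) :
    IsSeparable F η := by
  exact mem_separableClosure_iff.1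
    (IntermediateField.adjoin_simple_le_iff.2 (mem_separableClosure_iff.2 hξ) hη)

theorem IntermediateField.isSeparable_of_isSeparable_base {F k : Type*} [Field F] [Field k] [Algebra F k]
    (E : IntermediateField F k) {x : k} (hx : IsSeparable F x) : IsSeparable E x :=
  hx.tower_top E

theorem Subfield.isSeparable_trans {k : Type*} [Field k] {A B : Subfield k} (h : A ≤ B)
    (hAB : ∀ x ∈ B, IsSeparable A x) {x : k} (hx : IsSeparable B x) : IsSeparable A x :=
  IntermediateField.isSeparable_of_forall_mem (Subfield.extendScalars h) hAB hx

theorem Subfield.isSeparable_mono {k : Type*} [Field k] {A B : Subfield k} (h : A ≤ B)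
    {x : k} (hx : IsSeparable A x) : IsSeparable B x :=
  IntermediateField.isSeparable_of_isSeparable_base (Subfield.extendScalars h) hx

theorem TameSubfield.trans {A B C : Subfield L} (h₁ : TameSubfield v A B)
    (h₂ : TameSubfield v B C) : TameSubfield v A C where
  le := h₁.le.trans h₂.le
  finrank_ne_zero := by
    rw [← Subfield.relfinrank_mul_relfinrank h₁.le h₂.le]
    exact mul_ne_zero h₁.finrank_ne_zero h₂.finrank_ne_zero
  coprime := by
    rw [← Subgroup.relIndex_mul_relIndex _ _ _ (valueSubgroup_mono v h₁.le)
      (valueSubgroup_mono v h₂.le)]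
    exact h₁.coprime.mul_right h₂.coprime
  separable := fun ξ hξ => Subfield.isSeparable_trans (residueSubfield_mono v h₁.le) h₁.separable
    (h₂.separable ξ hξ)
  defectless := by
    rw [← Subfield.relfinrank_mul_relfinrank h₁.le h₂.le,
      ← Subgroup.relIndex_mul_relIndex _ _ _ (valueSubgroup_mono v h₁.le)
      (valueSubgroup_mono v h₂.le), ← Subfield.relfinrank_mul_relfinrank
      (residueSubfield_mono v h₁.le) (residueSubfield_mono v h₂.le), h₁.defectless, h₂.defectless]
    ring

theorem TameSubfield.refl (A : Subfield L) : TameSubfield v A A where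
  le := le_rfl
  finrank_ne_zero := by simp
  coprime := by simp
  separable := fun ξ hξ => isSeparable_algebraMap (⟨ξ, hξ⟩ : residueSubfield v A)
  defectless := by simp

/-- Both steps satisfy e f ≤ n. The products of the two sides agree because `C/A` is defectless, so
neither inequality can be strict. -/
theorem TameSubfield.tower {A B C : Subfield L} (h : TameSubfield v A C) (hAB : A ≤ B)
    (hBC : B ≤ C) : TameSubfield v A B ∧ TameSubfield v B C := by
  have hn := Subfield.relfinrank_mul_relfinrank hAB hBC
  have he := Subgroup.relIndex_mul_relIndex _ _ _ (valueSubgroup_mono v hAB)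
    (valueSubgroup_mono v hBC)
  have hf := Subfield.relfinrank_mul_relfinrank (residueSubfield_mono v hAB)
    (residueSubfield_mono v hBC)
  have hn0 := h.finrank_ne_zero
  rw [← hn] at hn0
  obtain ⟨h1, h2⟩ := mul_ne_zero_iff.1 hn0
  obtain ⟨i1, i2, i3⟩ := relIndex_mul_relfinrank_le v hAB h1
  obtain ⟨j1, j2, j3⟩ := relIndex_mul_relfinrank_le v hBC h2
  have hd := h.defectless
  rw [← hn, ← he, ← hf, mul_mul_mul_comm] at hd
  have hc := h.coprime
  rw [← he] at hc
  have e1 := i1.eq_of_not_lt fun hlt =>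
    (Nat.mul_lt_mul_of_lt_of_le hlt j1 (Nat.pos_of_ne_zero h2)).ne' hd
  have e2 := j1.eq_of_not_lt fun hlt =>
    (Nat.mul_lt_mul_of_le_of_lt i1 hlt (Nat.pos_of_ne_zero h1)).ne' hd
  exact ⟨⟨hAB, h1, hc.coprime_mul_right_right, fun ξ hξ => h.separable ξ
      (residueSubfield_mono v hBC hξ), e1.symm⟩,
    ⟨hBC, h2, hc.coprime_mul_left_right, fun ξ hξ => Subfield.isSeparable_mono
      (residueSubfield_mono v hAB) (h.separable ξ hξ), e2.symm⟩⟩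

end TameSubfields

/-! ### Adjoining simple roots: unramified extensions -/

section HenselianSteps

open Polynomial

variable {L Γ : Type*} [Field L] [LinearOrderedCommGroupWithZero Γ] (v : Valuation L Γ)

/-- Hensel's lemma holds in the subfield `F`. -/
def HenselianOn (F : Subfield L) : Prop :=
  ∀ Q : v.valuationSubring[X], Q.Monic → (∀ i, (Q.coeff i : L) ∈ F) →
    ∀ a : v.valuationSubring, (a : L) ∈ F → Q.eval a ∈ maximalIdeal v.valuationSubring →
      IsUnit (Q.derivative.eval a) →
        ∃ b : v.valuationSubring, (b : L) ∈ F ∧ Q.IsRoot b ∧ residue v.valuationSubring b =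
          residue v.valuationSubring a

variable {v}

theorem Subfield.exists_map_eq {F : Subfield L} (P : L[X]) (hP : ∀ i, P.coeff i ∈ F) :
    ∃ Q : F[X], Q.map (algebraMap F L) = P := by
  have : P ∈ lifts (algebraMap F L) := by
    rw [lifts_iff_coeff_lifts]
    exact fun i => ⟨⟨_, hP i⟩, rfl⟩
  exact (mem_lifts _).1 this

/-- A monic polynomial over the residue field of `A` lifts to a monic polynomial of the same degree
over the valuation ring of `A`. -/
theorem exists_monic_lift (A : Subfield L) (g : (residueSubfield v A)[X]) (hg : g.Monic) :
    ∃ Q : v.valuationSubring[X], Q.Monic ∧ Q.natDegree = g.natDegree ∧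
      (∀ i, (Q.coeff i : L) ∈ A) ∧
      Q.map (residue v.valuationSubring) = g.map (algebraMap (residueSubfield v A) (ResField v)) := by
  let OA : Subring v.valuationSubring := A.toSubring.comap v.valuationSubring.subtype
  let φ : OA →+* residueSubfield v A :=
    ((residue v.valuationSubring).comp OA.subtype).codRestrict (residueSubfield v A)
      fun x => ⟨x, x.2, rfl⟩
  have hφ : Function.Surjective φ := by
    rintro ⟨ξ, x, hx, rfl⟩
    exact ⟨⟨x, hx⟩, rfl⟩
  have hlift : g ∈ lifts φ := by
    rw [lifts_iff_coeff_lifts]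
    exact fun i => hφ _
  obtain ⟨q, hq, hqd, hqm⟩ := lifts_and_natDegree_eq_and_monic hlift hg
  refine ⟨q.map OA.subtype, hqm.map _, by rw [hqm.natDegree_map, hqd], fun i => ?_, ?_⟩
  · rw [coeff_map]
    exact (q.coeff i).2
  · rw [← hq, Polynomial.map_map, Polynomial.map_map]
    rfl

/-- The degree of a simple extension of subfields. -/
theorem Subfield.relfinrank_adjoin_simple (F : Subfield L) {β : L} (P : L[X]) (hm : P.Monic)
    (hP : ∀ i, P.coeff i ∈ F) (hβ : P.eval β = 0) :
    F ≤ (IntermediateField.adjoin F {β}).toSubfield ∧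
      F.relfinrank (IntermediateField.adjoin F {β}).toSubfield ≠ 0 ∧
      F.relfinrank (IntermediateField.adjoin F {β}).toSubfield ≤ P.natDegree := by
  have hle : F ≤ (IntermediateField.adjoin F {β}).toSubfield := fun x hx =>
    (IntermediateField.adjoin F {β}).algebraMap_mem ⟨x, hx⟩
  obtain ⟨Q, hQ⟩ := Subfield.exists_map_eq P hP
  have hQm : Q.Monic := by
    rw [← hQ] at hm
    exact (Function.Injective.monic_map_iff (algebraMap F L).injective).2 hm
  have hQβ : aeval β Q = 0 := by rw [← eval_map_algebraMap, hQ, hβ]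
  have hint : IsIntegral F β := ⟨Q, hQm, hQβ⟩
  have heq : F.relfinrank (IntermediateField.adjoin F {β}).toSubfield =
      (minpoly F β).natDegree := by
    rw [Subfield.relfinrank_eq_finrank_of_le hle, ← IntermediateField.adjoin.finrank hint]
    rfl
  refine ⟨hle, ?_, ?_⟩
  · rw [heq]; exact (minpoly.natDegree_pos hint).ne'
  · rw [heq, ← hQ, natDegree_map]
    exact natDegree_le_of_dvd (minpoly.dvd F β hQβ) hQm.ne_zero

theorem natCast_residue_ne_zero_iff_isUnit {m : ℕ} :
    (m : ResField v) ≠ 0 ↔ IsUnit (m : v.valuationSubring) := by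
  rw [← map_natCast (residue v.valuationSubring), Ne, residue_eq_zero_iff, mem_maximalIdeal,
    mem_nonunits_iff, not_not]

/-- An element whose residue is a simple root of the reduction of a polynomial over `F` lies in an
unramified extension of `F`. -/
theorem exists_tameSubfield_of_simple_root (F : Subfield L)
    (hH : ∀ F', F ≤ F' → HenselianOn v F') (P : v.valuationSubring[X]) (hm : P.Monic)
    (hP : ∀ i, (P.coeff i : L) ∈ F) (α : v.valuationSubring) (hα : P.eval α = 0)
    (hα' : IsUnit (P.derivative.eval α)) :
    ∃ F', (α : L) ∈ F' ∧ TameSubfield v F F' ∧ valueSubgroup v F' = valueSubgroup v F := by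
  set R := residueSubfield v F with hR
  set ξ := residue v.valuationSubring α with hξ
  obtain ⟨p, hp⟩ := Subfield.exists_map_eq (F := R) (P.map (residue v.valuationSubring))
    fun i => by rw [coeff_map]; exact ⟨_, hP i, rfl⟩
  have hpm : p.Monic := by
    refine (Function.Injective.monic_map_iff (algebraMap R (ResField v)).injective).2 ?_
    rw [hp]
    exact hm.map _
  have hpξ : aeval ξ p = 0 := by
    rw [← eval_map_algebraMap, hp, hξ, eval_map_apply, hα, map_zero]
  have hpξ' : aeval ξ p.derivative ≠ 0 := by
    rw [← eval_map_algebraMap, ← derivative_map, hp, hξ, derivative_map, eval_map_apply, Ne,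
      residue_eq_zero_iff, mem_maximalIdeal, mem_nonunits_iff, not_not]
    exact hα'
  have hint : IsIntegral R ξ := ⟨p, hpm, hpξ⟩
  set g := minpoly R ξ with hg
  have hsep : IsSeparable R ξ := by
    rw [IsSeparable, separable_iff_derivative_ne_zero (minpoly.irreducible hint)]
    intro hd
    obtain ⟨r, hr⟩ := minpoly.dvd R ξ hpξ
    apply hpξ'
    rw [hr, derivative_mul, hd]
    simp
  obtain ⟨G, hGm, hGd, hGF, hGg⟩ := exists_monic_lift F g (minpoly.monic hint)
  have hGα : G.eval α ∈ maximalIdeal v.valuationSubring := by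
    rw [← residue_eq_zero_iff, ← eval_map_apply, hGg, eval_map_algebraMap]
    exact minpoly.aeval _ _
  have hGα' : IsUnit (G.derivative.eval α) := by
    have h := Separable.aeval_derivative_ne_zero hsep (minpoly.aeval R ξ)
    rwa [← eval_map_algebraMap, ← derivative_map, ← hg, ← hGg, derivative_map, hξ, eval_map_apply,
      Ne, residue_eq_zero_iff, mem_maximalIdeal, mem_nonunits_iff, not_not] at h
  -- `P` may have too large a degree, so instead of `α` one adjoins a root `β` of a lift of the
  -- minimal polynomial of its residue. Then [F(β):F] is at most the degree of that residue, which
  -- bounds the residue degree from below, and the fundamental inequality forces e = 1 and f = n.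
  obtain ⟨β, -, hβ, hβα⟩ := hH ⊤ le_top G hGm (fun _ => Subfield.mem_top _) α
    (Subfield.mem_top _) hGα hGα'
  set F' := (IntermediateField.adjoin F {(β : L)}).toSubfield with hF'
  have hβF' : (β : L) ∈ F' := IntermediateField.mem_adjoin_simple_self F (β : L)
  obtain ⟨hle, hn0, hn⟩ := Subfield.relfinrank_adjoin_simple F (β := (β : L))
    (G.map (algebraMap v.valuationSubring L)) (hGm.map _)
    (fun i => by rw [coeff_map]; exact hGF i) (by
      have := eval_map_apply (p := G) (algebraMap v.valuationSubring L) β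
      rw [hβ.eq_zero, map_zero] at this
      exact this)
  rw [hGm.natDegree_map, hGd, ← hF'] at hn
  rw [← hF'] at hle hn0
  have hαF' : (α : L) ∈ F' := by
    have hsub : β - α ∈ maximalIdeal v.valuationSubring := by
      rw [← residue_eq_zero_iff, map_sub, hβα, sub_self]
    -- Hensel's lemma for `P` inside F(β), started at `β`, gives a root with the residue of `α`; a
    -- simple root is determined by its residue.
    obtain ⟨γ, hγF, hγ, hγβ⟩ := hH F' hle P hm (fun i => hle (hP i)) β hβF' (by
        rw [← residue_eq_zero_iff, ← eval_map_apply, hβα, eval_map_apply, hα, map_zero]) (by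
        rw [← notMem_maximalIdeal, ← residue_eq_zero_iff, ← eval_map_apply, hβα, eval_map_apply,
          residue_eq_zero_iff, notMem_maximalIdeal]
        exact hα')
    have : α = γ := by
      refine IsLocalRing.eq_of_eval_eq_zero_of_not_isUnit_sub hα hγ.eq_zero ?_ hα'
      rw [← mem_nonunits_iff, ← mem_maximalIdeal, ← residue_eq_zero_iff, map_sub, hγβ, hβα,
        sub_self]
    rw [this]
    exact hγF
  obtain ⟨hef, he0, hf0⟩ := relIndex_mul_relfinrank_le v hle hn0
  have hRle : R ≤ residueSubfield v F' := residueSubfield_mono v hle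
  set E : IntermediateField R (ResField v) := Subfield.extendScalars hRle with hE
  have hfE : R.relfinrank (residueSubfield v F') = Module.finrank R E :=
    Subfield.relfinrank_eq_finrank_of_le hRle
  rw [← hR, hfE] at hf0 hef
  have hEfin : FiniteDimensional R E := FiniteDimensional.of_finrank_pos (Nat.pos_of_ne_zero hf0)
  have hξE : IntermediateField.adjoin R {ξ} ≤ E := by
    rw [IntermediateField.adjoin_simple_le_iff]
    exact ⟨α, hαF', rfl⟩
  have hdeg : Module.finrank R (IntermediateField.adjoin R {ξ}) = g.natDegree :=
    IntermediateField.adjoin.finrank hint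
  have hgE : g.natDegree ≤ Module.finrank R E := hdeg ▸
    IntermediateField.finrank_le_of_le_right hξE
  have hfpos := Nat.pos_of_ne_zero hf0
  have he1 : (valueSubgroup v F).relIndex (valueSubgroup v F') = 1 := by
    have h3 : (valueSubgroup v F).relIndex (valueSubgroup v F') * Module.finrank R E ≤
        1 * Module.finrank R E := by
      rw [one_mul]
      exact hef.trans (hn.trans hgE)
    have := Nat.le_of_mul_le_mul_right h3 hfpos
    omega
  rw [he1, one_mul] at hef
  have hEeq : IntermediateField.adjoin R {ξ} = E :=
    IntermediateField.eq_of_le_of_finrank_le hξE (by rw [hdeg]; exact hef.trans hn)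
  refine ⟨F', hαF', ⟨hle, hn0, ?_, ?_, ?_⟩, ?_⟩
  · rw [he1]; exact Nat.coprime_one_right _
  · intro η hη
    have hη' : η ∈ IntermediateField.adjoin R {ξ} := by rw [hEeq]; exact hη
    exact IntermediateField.isSeparable_of_mem_adjoin_simple hsep hη'
  · rw [he1, one_mul, ← hR, hfE]
    exact le_antisymm (hn.trans hgE) hef
  · exact le_antisymm (Subgroup.relIndex_eq_one.1 he1) (valueSubgroup_mono v hle)

end HenselianSteps

/-! ### Radicals, and stability of tameness under base change -/

section TameBaseChange

open Polynomial

variable {L Γ : Type*} [Field L] [LinearOrderedCommGroupWithZero Γ] {v : Valuation L Γ}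

theorem Nat.Cast.ne_zero_iff_coprime_ringExpChar {k : Type*} [Field k] {m : ℕ} (hm : m ≠ 0) :
    (m : k) ≠ 0 ↔ (ringExpChar k).Coprime m := by
  obtain ⟨p, hp⟩ := ExpChar.exists k
  rw [ringExpChar.eq k p]
  cases hp with
  | zero => simpa using hm
  | prime hprime =>
    rw [Ne, CharP.cast_eq_zero_iff k p, Nat.Prime.coprime_iff_not_dvd hprime]

theorem isUnit_natCast_of_dvd {R : Type*} [CommRing R] {l m : ℕ} (h : l ∣ m)
    (hm : IsUnit (m : R)) : IsUnit (l : R) :=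
  isUnit_of_dvd_unit (Nat.cast_dvd_cast h) hm

theorem isUnit_iff_valuation_eq_one (x : v.valuationSubring) : IsUnit x ↔ v x = 1 :=
  (Valuation.valuationSubring.integers v).isUnit_iff_valuation_eq_one

theorem isUnit_eval_derivative_X_pow_sub_C {R : Type*} [CommRing R] {l : ℕ}
    (hl : IsUnit (l : R)) (w : R) {u : R} (hu : IsUnit u) :
    IsUnit ((X ^ l - C w : R[X]).derivative.eval u) := by
  simp only [derivative_sub, derivative_X_pow, derivative_C, sub_zero, eval_mul, eval_pow, eval_X,
    eval_C]
  exact hl.mul (hu.pow _)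

theorem coeff_X_pow_sub_C_mem (F : Subfield L) (l : ℕ) {w : v.valuationSubring} (hw : (w : L) ∈ F)
    (i : ℕ) : ((X ^ l - C w : v.valuationSubring[X]).coeff i : L) ∈ F := by
  rw [coeff_sub, coeff_X_pow, coeff_C]
  refine F.sub_mem ?_ ?_
  · split_ifs
    · exact F.one_mem
    · exact F.zero_mem
  · split_ifs
    · exact hw
    · exact F.zero_mem

/-- An `m`-th root of an element of `F`, with `m` prime to the residue characteristic, lies in a
tame extension of `F`. -/
theorem exists_tameSubfield_of_pow_mem (F : Subfield L)
    (hH : ∀ F', F ≤ F' → HenselianOn v F') {a : L} (ha : a ≠ 0) {m : ℕ} (ham : a ^ m ∈ F)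
    (hm : (m : ResField v) ≠ 0) : ∃ F', a ∈ F' ∧ TameSubfield v F F' := by
  have hm0 : m ≠ 0 := by rintro rfl; simp at hm
  set γ : Γˣ := Units.mk0 (v a) (v.ne_zero_iff.2 ha) with hγ
  have hγpow : ∀ j : ℕ, v (a ^ j) = (γ ^ j : Γˣ) := fun j => by simp [hγ]
  set q : Γˣ ⧸ valueSubgroup v F := QuotientGroup.mk γ with hq
  have hqpow : ∀ j : ℕ, γ ^ j ∈ valueSubgroup v F ↔ orderOf q ∣ j := by
    intro j
    rw [orderOf_dvd_iff_pow_eq_one, hq, ← QuotientGroup.mk_pow, QuotientGroup.eq_one_iff]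
  -- With `k` the order of the value of `a` modulo the value group of `F`, write m = k l and a^k = u
  -- b, where b is in `F` and `u` is a unit. Then `u` is a simple root of X^l - u^l and generates no
  -- ramification; the remaining root of order `k` is totally ramified.
  set k := orderOf q with hk
  have hkm : k ∣ m := (hqpow m).1 ⟨a ^ m, ham, hγpow m⟩
  obtain ⟨l, hl⟩ := hkm
  have hk0 : k ≠ 0 := by rintro h; simp [h] at hl; exact hm0 hl
  have hl0 : l ≠ 0 := by rintro h; simp [h] at hl; exact hm0 hl
  obtain ⟨b, hbF, hb⟩ := (hqpow k).2 dvd_rfl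
  have hb0 : b ≠ 0 := by rw [← v.ne_zero_iff, hb]; exact Units.ne_zero _
  have hu1 : v (a ^ k / b) = 1 := by
    rw [map_div₀, hb, hγpow, div_self (Units.ne_zero _)]
  set u : v.valuationSubring := ⟨a ^ k / b, hu1.le⟩ with hu
  have huu : IsUnit u := (isUnit_iff_valuation_eq_one u).2 hu1
  have hwF : ((u ^ l : v.valuationSubring) : L) ∈ F := by
    have : ((u ^ l : v.valuationSubring) : L) = a ^ m / b ^ l := by
      rw [hl, pow_mul, ← div_pow]
      rfl
    rw [this]
    exact F.div_mem ham (F.pow_mem hbF _)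
  have hmu : IsUnit (m : v.valuationSubring) := natCast_residue_ne_zero_iff_isUnit.1 hm
  have hlu : IsUnit (l : v.valuationSubring) := isUnit_natCast_of_dvd ⟨k, by rw [hl, mul_comm]⟩ hmu
  obtain ⟨F₁, huF₁, htame₁, hval⟩ := exists_tameSubfield_of_simple_root F hH
    (X ^ l - C (u ^ l)) (monic_X_pow_sub_C _ hl0) (coeff_X_pow_sub_C_mem F l hwF) u (by simp)
    (isUnit_eval_derivative_X_pow_sub_C hlu _ huu)
  have hak : a ^ k ∈ F₁ := by
    have : a ^ k = (u : L) * b := by rw [hu]; exact (div_mul_cancel₀ _ hb0).symm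
    rw [this]
    exact F₁.mul_mem huF₁ (htame₁.le hbF)
  obtain ⟨hle, hn0, hn⟩ := Subfield.relfinrank_adjoin_simple F₁ (β := a)
    (X ^ k - C (a ^ k)) (monic_X_pow_sub_C _ hk0) (fun i => by
      rw [coeff_sub, coeff_X_pow, coeff_C]
      refine F₁.sub_mem ?_ ?_
      · split_ifs
        · exact F₁.one_mem
        · exact F₁.zero_mem
      · split_ifs
        · exact hak
        · exact F₁.zero_mem) (by simp)
  rw [natDegree_X_pow_sub_C] at hn
  set F₂ := (IntermediateField.adjoin F₁ {a}).toSubfield with hF₂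
  have haF₂ : a ∈ F₂ := IntermediateField.mem_adjoin_simple_self F₁ a
  obtain ⟨hef, he0, hf0⟩ := relIndex_mul_relfinrank_le v hle hn0
  have hγF₂ : γ ∈ valueSubgroup v F₂ := ⟨a, haF₂, rfl⟩
  -- `F₁` has the value group of `F`, so the value of `a` still has order `k` modulo it. Hence e ≥
  -- k, while the degree is at most `k`.
  have hke : k ∣ (valueSubgroup v F₁).relIndex (valueSubgroup v F₂) := by
    rw [← hqpow, ← hval]
    exact Subgroup.pow_relIndex_mem _ hγF₂
  have hke' := Nat.le_of_dvd (Nat.pos_of_ne_zero he0) hke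
  have hfpos := Nat.pos_of_ne_zero hf0
  have hee : (valueSubgroup v F₁).relIndex (valueSubgroup v F₂) = k :=
    le_antisymm ((Nat.le_mul_of_pos_right _ hfpos).trans (hef.trans hn)) hke'
  rw [hee] at hef
  have hf1 : (residueSubfield v F₁).relfinrank (residueSubfield v F₂) = 1 := by
    have : k * (residueSubfield v F₁).relfinrank (residueSubfield v F₂) ≤ k * 1 := by
      rw [mul_one]; exact hef.trans hn
    have := Nat.le_of_mul_le_mul_left this (Nat.pos_of_ne_zero hk0)
    omega
  rw [hf1, mul_one] at hef
  refine ⟨F₂, haF₂, htame₁.trans ⟨hle, hn0, ?_, ?_, ?_⟩⟩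
  · rw [hee, ← Nat.Cast.ne_zero_iff_coprime_ringExpChar hk0]
    exact natCast_residue_ne_zero_iff_isUnit.2 (isUnit_natCast_of_dvd ⟨l, hl⟩ hmu)
  · intro ξ hξ
    have hξ' := Subfield.relfinrank_eq_one_iff.1 hf1 hξ
    exact isSeparable_algebraMap (⟨ξ, hξ'⟩ : residueSubfield v F₁)
  · rw [hee, hf1, mul_one]
    exact le_antisymm hn hef

/-- A finite tame extension `B` of `A` is contained in every extension `F` of `A` in which all
integral simple roots over `F` and all roots of order prime to the residue characteristic of
elements of `F` lie. -/
theorem TameSubfield.le_of_closed {A B F : Subfield L} (hAB : TameSubfield v A B) (hAF : A ≤ F)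
    (hB : HenselianOn v B)
    (hroot : ∀ (P : v.valuationSubring[X]), P.Monic → (∀ i, (P.coeff i : L) ∈ F) →
      ∀ α : v.valuationSubring, P.eval α = 0 → IsUnit (P.derivative.eval α) → (α : L) ∈ F)
    (hrad : ∀ (a : L) (m : ℕ), a ≠ 0 → a ^ m ∈ F → (m : ResField v) ≠ 0 → a ∈ F) : B ≤ F := by
  -- It suffices that `B` and F ∩ B have the same residue field and value group: `B` is tame over F
  -- ∩ B, so its degree e f is then 1.
  have hAM : A ≤ F ⊓ B := le_inf hAF hAB.le
  have hres : residueSubfield v B ≤ residueSubfield v (F ⊓ B) := by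
    rintro _ ⟨α₀, hα₀, rfl⟩
    have hsep := hAB.separable _ ⟨α₀, hα₀, rfl⟩
    obtain ⟨G, hGm, -, hGA, hGg⟩ := exists_monic_lift A _ (minpoly.monic hsep.isIntegral)
    have h1 : G.eval α₀ ∈ maximalIdeal v.valuationSubring := by
      rw [← residue_eq_zero_iff, ← eval_map_apply, hGg, eval_map_algebraMap]
      exact minpoly.aeval _ _
    have h2 : IsUnit (G.derivative.eval α₀) := by
      rw [← notMem_maximalIdeal, ← residue_eq_zero_iff, ← eval_map_apply, ← derivative_map, hGg,
        derivative_map, eval_map_algebraMap]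
      exact Separable.aeval_derivative_ne_zero hsep (minpoly.aeval _ _)
    obtain ⟨α, hαB, hα, hαα₀⟩ := hB G hGm (fun i => hAB.le (hGA i)) α₀ hα₀ h1 h2
    refine ⟨α, ⟨hroot G hGm (fun i => hAF (hGA i)) α hα.eq_zero ?_, hαB⟩, hαα₀⟩
    rw [← notMem_maximalIdeal, ← residue_eq_zero_iff, ← eval_map_apply, hαα₀, eval_map_apply,
      residue_eq_zero_iff, notMem_maximalIdeal]
    exact h2
  obtain ⟨-, he0, -⟩ := relIndex_mul_relfinrank_le v hAB.le hAB.finrank_ne_zero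
  set e := (valueSubgroup v A).relIndex (valueSubgroup v B) with he
  have hek : (e : ResField v) ≠ 0 := (Nat.Cast.ne_zero_iff_coprime_ringExpChar he0).2 hAB.coprime
  have heu : IsUnit (e : v.valuationSubring) := natCast_residue_ne_zero_iff_isUnit.1 hek
  have hval : valueSubgroup v B ≤ valueSubgroup v (F ⊓ B) := by
    rintro γ ⟨a, haB, ha⟩
    have ha0 : a ≠ 0 := by rw [← v.ne_zero_iff, ha]; exact Units.ne_zero _
    obtain ⟨c, hcA, hc⟩ : γ ^ e ∈ valueSubgroup v A := Subgroup.pow_relIndex_mem _ ⟨a, haB, ha⟩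
    have hc0 : c ≠ 0 := by rw [← v.ne_zero_iff, hc]; exact Units.ne_zero _
    have hu1 : v (a ^ e / c) = 1 := by
      rw [map_div₀, hc, map_pow, ha, ← Units.val_pow_eq_pow_val, div_self (Units.ne_zero _)]
    -- The unit a^e / c need not lie in `F`, but some `w` in F ∩ B has the same residue. The
    -- quotient t is then 1 modulo the maximal ideal, so Hensel's lemma in `B` gives z^e = t.
    -- Replacing `a` by a / z keeps the value and makes the e-th power c w, which lies in `F`.
    obtain ⟨w, hwM, hw⟩ := hres (x := residue _ (⟨a ^ e / c, hu1.le⟩ : v.valuationSubring))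
      ⟨_, B.div_mem (B.pow_mem haB _) (hAB.le hcA), rfl⟩
    have huu : IsUnit (⟨a ^ e / c, hu1.le⟩ : v.valuationSubring) :=
      (isUnit_iff_valuation_eq_one _).2 hu1
    have hwu : IsUnit w := by
      rw [← notMem_maximalIdeal, ← residue_eq_zero_iff, hw, residue_eq_zero_iff,
        notMem_maximalIdeal]
      exact huu
    have hw1 := (isUnit_iff_valuation_eq_one w).1 hwu
    have hw0 : (w : L) ≠ 0 := by rw [← v.ne_zero_iff, hw1]; exact one_ne_zero
    obtain ⟨w', hw'⟩ := isUnit_iff_exists_inv.1 hwu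
    have hw'L : (w' : L) = (w : L)⁻¹ := eq_inv_of_mul_eq_one_right (congrArg Subtype.val hw')
    set t : v.valuationSubring := ⟨a ^ e / c, hu1.le⟩ * w' with ht
    have htB : (t : L) ∈ B := B.mul_mem (B.div_mem (B.pow_mem haB _) (hAB.le hcA))
      (by rw [hw'L]; exact B.inv_mem hwM.2)
    have htres : residue v.valuationSubring t = 1 := by
      rw [ht, map_mul, ← hw, ← map_mul, hw', map_one]
    obtain ⟨z, hzB, hz, hz1⟩ := hB (X ^ e - C t) (monic_X_pow_sub_C _ he0)
      (coeff_X_pow_sub_C_mem B e htB) 1 B.one_mem (by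
        rw [← residue_eq_zero_iff]
        simp [htres]) (isUnit_eval_derivative_X_pow_sub_C heu _ isUnit_one)
    have hze : (z : L) ^ e = a ^ e / c * (w : L)⁻¹ := by
      have h := hz.eq_zero
      simp only [eval_sub, eval_pow, eval_X, eval_C, sub_eq_zero] at h
      rw [← hw'L]
      exact congrArg Subtype.val h
    have hzu : IsUnit z := by
      rw [← notMem_maximalIdeal, ← residue_eq_zero_iff, hz1, map_one]
      exact one_ne_zero
    have hvz := (isUnit_iff_valuation_eq_one z).1 hzu
    have hz0 : (z : L) ≠ 0 := by rw [← v.ne_zero_iff, hvz]; exact one_ne_zero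
    refine ⟨a / z, ⟨hrad _ e (div_ne_zero ha0 hz0) ?_ hek, B.div_mem haB hzB⟩, ?_⟩
    · have : (a / z) ^ e = c * w := by
        rw [div_pow, hze]
        field_simp
      rw [this]
      exact F.mul_mem (hAF hcA) hwM.1
    · rw [map_div₀, hvz, div_one, ha]
  have htame := (hAB.tower hAM inf_le_right).2
  have h1 := htame.defectless
  rw [Subgroup.relIndex_eq_one.2 hval, Subfield.relfinrank_eq_one_iff.2 hres, mul_one] at h1
  exact (Subfield.relfinrank_eq_one_iff.1 h1).trans inf_le_left

/-- Tame extensions of henselian fields are stable under base change. -/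
theorem TameSubfield.base_change {A B C : Subfield L} (hAB : TameSubfield v A B) (hAC : A ≤ C)
    (hH : ∀ F, A ≤ F → HenselianOn v F) (hC : C.relfinrank ⊤ ≠ 0) (hBC : B ⊔ C = ⊤) :
    TameSubfield v C ⊤ := by
  have hbound : ∀ F, TameSubfield v C F → C.relfinrank F ≤ C.relfinrank ⊤ := fun F hF =>
    Nat.le_of_dvd (Nat.pos_of_ne_zero hC)
      ⟨_, (Subfield.relfinrank_mul_relfinrank hF.le le_top).symm⟩
  -- Degrees of tame extensions of `C` are bounded by [L:C], so a maximal one exists; by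
  -- transitivity it has no proper tame extension.
  obtain ⟨n, ⟨F, hF, rfl⟩, hmax⟩ : ∃ n, (∃ F, TameSubfield v C F ∧ C.relfinrank F = n) ∧
      ∀ F, TameSubfield v C F → C.relfinrank F ≤ n := by
    classical
    let p : ℕ → Prop := fun n => ∃ F, TameSubfield v C F ∧ C.relfinrank F = n
    have hp : p (C.relfinrank C) := ⟨C, TameSubfield.refl C, rfl⟩
    refine ⟨Nat.findGreatest p (C.relfinrank ⊤), Nat.findGreatest_spec
      (hbound C (TameSubfield.refl C)) hp, fun F hF => ?_⟩
    exact Nat.le_findGreatest (hbound F hF) ⟨F, hF, rfl⟩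
  have hclosed : ∀ F', TameSubfield v F F' → F' ≤ F := by
    intro F' hF'
    have h := hmax F' (hF.trans hF')
    rw [← Subfield.relfinrank_mul_relfinrank hF.le hF'.le] at h
    have h1 : F.relfinrank F' ≤ 1 := by
      refine Nat.le_of_mul_le_mul_left ?_ (Nat.pos_of_ne_zero hF.finrank_ne_zero)
      rwa [mul_one]
    have h0 := hF'.finrank_ne_zero
    exact Subfield.relfinrank_eq_one_iff.1 (by omega)
  have hHF : ∀ F', F ≤ F' → HenselianOn v F' := fun F' h => hH F' ((hAC.trans hF.le).trans h)
  have hBF : B ≤ F := by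
    refine hAB.le_of_closed (hAC.trans hF.le) (hH B hAB.le) ?_ ?_
    · intro P hm hP α hα hα'
      obtain ⟨F', hαF', hF', -⟩ := exists_tameSubfield_of_simple_root F hHF P hm hP α hα hα'
      exact hclosed F' hF' hαF'
    · intro a m ha ham hm
      obtain ⟨F', haF', hF'⟩ := exists_tameSubfield_of_pow_mem F hHF ha ham hm
      exact hclosed F' hF' haF'
  have : F = ⊤ := top_le_iff.1 (hBC ▸ sup_le hBF hF.le)
  exact this ▸ hF

end TameBaseChange

/-! ### From field extensions to subfields of one valued field -/

section Transfer

open Polynomial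

theorem finrank_eq_relfinrank_fieldRange {F E k : Type*} [Field F] [Field E] [Field k]
    [Algebra F E] (j : E →+* k) :
    Module.finrank F E = (j.comp (algebraMap F E)).fieldRange.relfinrank j.fieldRange := by
  have hle : (j.comp (algebraMap F E)).fieldRange ≤ j.fieldRange := by
    rintro _ ⟨x, rfl⟩
    exact ⟨_, rfl⟩
  rw [Subfield.relfinrank_eq_finrank_of_le hle]
  exact Algebra.finrank_eq_of_equiv_equiv (S₁ := Subfield.extendScalars hle)
    (RingHom.rangeRestrictFieldEquiv _) (RingHom.rangeRestrictFieldEquiv j)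
    (RingHom.ext fun _ => rfl)

theorem isSeparable_iff_forall_fieldRange {F E k : Type*} [Field F] [Field E] [Field k]
    [Algebra F E] (j : E →+* k) :
    Algebra.IsSeparable F E ↔
      ∀ ξ ∈ j.fieldRange, IsSeparable (j.comp (algebraMap F E)).fieldRange ξ := by
  let e₁ := RingHom.rangeRestrictFieldEquiv (j.comp (algebraMap F E))
  have key : ∀ x : E, IsSeparable (j.comp (algebraMap F E)).fieldRange (j x) ↔ IsSeparable F x := by
    intro x
    let _ : Algebra F k := (j.comp (algebraMap F E)).toAlgebra
    have h1 : IsSeparable F (j x) ↔ IsSeparable F x :=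
      isSeparable_map_iff ({ j with commutes' := fun _ => rfl } : E →ₐ[F] k) j.injective
    rw [← h1]
    constructor
    · intro h
      exact IsSeparable.of_equiv_equiv e₁.symm (RingEquiv.refl k) (by
        ext y
        obtain ⟨z, rfl⟩ := e₁.surjective y
        simp only [RingHom.comp_apply, RingEquiv.coe_toRingHom, RingEquiv.symm_apply_apply]
        rfl) h
    · intro h
      exact IsSeparable.of_equiv_equiv e₁ (RingEquiv.refl k) (RingHom.ext fun _ => rfl) h
  constructor
  · rintro h _ ⟨x, rfl⟩
    exact (key x).2 (Algebra.IsSeparable.isSeparable F x)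
  · exact fun h => ⟨fun x => (key x).1 (h _ ⟨x, rfl⟩)⟩

variable {F E L Γ : Type*} [Field F] [Field E] [Field L] [Algebra F E]
  [LinearOrderedCommGroupWithZero Γ] (v : Valuation L Γ) (i : E →+* L)

theorem valGroup_comap : valGroup (v.comap i) = valueSubgroup v i.fieldRange := by
  ext γ
  rw [MonoidWithZeroHom.mem_valueGroup_iff_of_comm, mem_valueSubgroup]
  constructor
  · rintro ⟨a, ha, x, hx⟩
    have ha' : v (i a) ≠ 0 := ha
    have hx' : v (i a) * γ = v (i x) := hx
    refine ⟨i (x / a), ⟨_, rfl⟩, ?_⟩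
    rw [map_div₀, map_div₀, ← hx', mul_div_cancel_left₀ _ ha']
  · rintro ⟨_, ⟨x, rfl⟩, hx⟩
    refine ⟨1, by simp, x, ?_⟩
    rw [map_one, one_mul]
    exact hx.symm

theorem ramIndex_comap : ramIndex F (v.comap i) =
    (valueSubgroup v (i.comp (algebraMap F E)).fieldRange).relIndex
      (valueSubgroup v i.fieldRange) := by
  rw [← valGroup_comap v i, ← valGroup_comap v (i.comp (algebraMap F E))]
  rfl

/-- The map of valuation rings induced by an embedding of valued fields. -/
def valuationSubringMap : (v.comap i).valuationSubring →+* v.valuationSubring :=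
  (i.comp (v.comap i).valuationSubring.subtype).codRestrict v.valuationSubring.toSubring
    fun x => x.2

instance : IsLocalHom (valuationSubringMap v i) where
  map_nonunit x hx := by
    rw [isUnit_iff_valuation_eq_one] at hx ⊢
    exact hx

/-- The map of residue fields induced by an embedding of valued fields. -/
noncomputable def resFieldMap : ResField (v.comap i) →+* ResField v :=
  ResidueField.map (valuationSubringMap v i)

theorem resFieldMap_fieldRange : (resFieldMap v i).fieldRange = residueSubfield v i.fieldRange := by
  ext ξ
  rw [mem_residueSubfield, RingHom.mem_fieldRange]
  constructor
  · rintro ⟨y, rfl⟩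
    obtain ⟨x, rfl⟩ := residue_surjective y
    exact ⟨valuationSubringMap v i x, ⟨_, rfl⟩, rfl⟩
  · rintro ⟨⟨_, hx⟩, ⟨x, rfl⟩, rfl⟩
    exact ⟨residue _ ⟨x, hx⟩, rfl⟩

theorem resFieldMap_comp_algebraMap_fieldRange :
    ((resFieldMap v i).comp (algebraMap (ResField (resVal F (v.comap i)))
      (ResField (v.comap i)))).fieldRange =
        residueSubfield v (i.comp (algebraMap F E)).fieldRange := by
  ext ξ
  rw [mem_residueSubfield, RingHom.mem_fieldRange]
  constructor
  · rintro ⟨y, rfl⟩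
    obtain ⟨x, rfl⟩ := residue_surjective y
    exact ⟨valuationSubringMap v i (algebraMap _ _ x), ⟨_, rfl⟩, rfl⟩
  · rintro ⟨⟨_, hx⟩, ⟨x, rfl⟩, rfl⟩
    exact ⟨residue _ ⟨x, hx⟩, rfl⟩

theorem resDegree_comap : resDegree F (v.comap i) =
    (residueSubfield v (i.comp (algebraMap F E)).fieldRange).relfinrank
      (residueSubfield v i.fieldRange) := by
  rw [resDegree, finrank_eq_relfinrank_fieldRange (resFieldMap v i),
    resFieldMap_comp_algebraMap_fieldRange, resFieldMap_fieldRange]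

theorem ringExpChar_eq_of_ringHom {k k' : Type*} [Field k] [Field k'] (f : k →+* k') :
    ringExpChar k = ringExpChar k' := by
  have := ringExpChar.expChar k'
  have := f.expChar f.injective (ringExpChar k')
  exact ringExpChar.eq k (ringExpChar k')

/-- Degree, ramification index, residue degree and separability are carried along the embeddings
into `L` and its residue field. The characteristic exponent can be read in the residue field of `L`,
since field embeddings preserve it. -/
theorem tameSubfield_fieldRange_iff :
    TameSubfield v (i.comp (algebraMap F E)).fieldRange i.fieldRange ↔
      FiniteDimensional F E ∧
      (ringExpChar (ResField (resVal F (v.comap i)))).Coprime (ramIndex F (v.comap i)) ∧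
      Algebra.IsSeparable (ResField (resVal F (v.comap i))) (ResField (v.comap i)) ∧
      Module.finrank F E = ramIndex F (v.comap i) * resDegree F (v.comap i) := by
  have hchar : ringExpChar (ResField (resVal F (v.comap i))) = ringExpChar (ResField v) :=
    ringExpChar_eq_of_ringHom ((resFieldMap v i).comp (algebraMap _ _))
  rw [hchar, isSeparable_iff_forall_fieldRange (resFieldMap v i),
    resFieldMap_comp_algebraMap_fieldRange, resFieldMap_fieldRange, ramIndex_comap,
    resDegree_comap, finrank_eq_relfinrank_fieldRange (F := F) i]
  constructor
  · intro h
    refine ⟨?_, h.coprime, h.separable, h.defectless⟩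
    refine FiniteDimensional.of_finrank_pos (Nat.pos_of_ne_zero ?_)
    rw [finrank_eq_relfinrank_fieldRange (F := F) i]
    exact h.finrank_ne_zero
  · rintro ⟨h0, h1, h2, h3⟩
    refine ⟨?_, ?_, h1, h2, h3⟩
    · rintro _ ⟨x, rfl⟩
      exact ⟨_, rfl⟩
    · rw [← finrank_eq_relfinrank_fieldRange (F := F) i]
      exact Module.finrank_pos.ne'

end Transfer

/-! ### Hensel's lemma in all intermediate fields -/

section HenselianOnSubfields

open Polynomial

variable {K L Γ : Type*} [Field K] [Field L] [Algebra K L] [LinearOrderedCommGroupWithZero Γ]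

theorem henselianOn_of_henselian [FiniteDimensional K L] (v : Valuation L Γ)
    (hK : HenselianLocalRing (resVal K v).valuationSubring) (F : Subfield L)
    (hF : (algebraMap K L).fieldRange ≤ F) : HenselianOn v F := by
  intro Q hQ hQF a haF ha ha'
  let E : IntermediateField K L := F.toIntermediateField fun x => hF ⟨x, rfl⟩
  have hv : ∀ x : E, resVal E v x = v (x : L) := fun _ => rfl
  obtain ⟨P, hP⟩ := Subfield.exists_map_eq (F := E.toSubfield)
    (Q.map (algebraMap v.valuationSubring L)) fun i => by rw [coeff_map]; exact hQF i
  have hQe : ∀ (R : v.valuationSubring[X]) (z : v.valuationSubring),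
      (R.map (algebraMap v.valuationSubring L)).eval (z : L) = R.eval z :=
    fun R z => eval_map_apply (algebraMap v.valuationSubring L) z
  have hPe : ∀ (R : E[X]) (z : E), (R.map (algebraMap E L)).eval (z : L) = R.eval z :=
    fun R z => eval_map_apply (algebraMap E L) z
  change E[X] at P
  have hP' : P.map (algebraMap E L) = Q.map (algebraMap v.valuationSubring L) := hP
  have hPm : P.Monic := by
    refine (Function.Injective.monic_map_iff (algebraMap E L).injective).2 ?_
    rw [hP']
    exact hQ.map _
  obtain ⟨b, hb, hba⟩ := exists_root_of_henselian (resVal K v) (resVal E v) (fun _ => Iff.rfl) P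
    hPm (fun i => by
      rw [hv]
      have : ((P.coeff i : E) : L) = Q.coeff i := by
        have h := congrArg (fun R => R.coeff i) hP'
        simp only [coeff_map] at h
        exact h
      rw [this]
      exact (Q.coeff i).2) ⟨a, haF⟩ a.2 (by
      rw [hv, ← hPe, hP', hQe, ← v.mem_maximalIdeal_valuationSubring]
      exact ha) (by
      rw [hv, ← hPe, ← derivative_map, hP', derivative_map, hQe, ← isUnit_iff_valuation_eq_one]
      exact ha')
  have hbL : (Q.map (algebraMap v.valuationSubring L)).eval (b : L) = 0 := by
    rw [← hP', hPe, hb]; rfl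
  have hb1 : v (b : L) ≤ 1 := v.le_one_of_root (hQ.map _)
    (fun i => by rw [coeff_map]; exact (Q.coeff i).2) hbL
  refine ⟨⟨b, hb1⟩, b.2, Subtype.ext ((hQe Q ⟨b, hb1⟩).symm.trans hbL), ?_⟩
  rw [← sub_eq_zero, ← map_sub, v.residue_eq_zero]
  exact hba

end HenselianOnSubfields

/-! ### Invariants of intermediate fields and the compositum -/

section Compositum

variable {K L Γ : Type*} [Field K] [Field L] [Algebra K L] [LinearOrderedCommGroupWithZero Γ]
  (v : Valuation L Γ)

theorem IntermediateField.fieldRange_algebraMap_eq (M : IntermediateField K L) :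
    (algebraMap M L).fieldRange = M.toSubfield := by
  ext x
  exact ⟨fun ⟨y, hy⟩ => hy ▸ y.2, fun hx => ⟨⟨x, hx⟩, rfl⟩⟩

theorem IntermediateField.fieldRange_algebraMap_comp (M : IntermediateField K L) :
    ((algebraMap M L).comp (algebraMap K M)).fieldRange = (algebraMap K L).fieldRange := rfl

theorem RingHom.fieldRange_id (L : Type*) [Field L] : (RingHom.id L).fieldRange = ⊤ :=
  RingHom.fieldRange_eq_top_iff.2 Function.surjective_id

theorem ramIndex_eq_relIndex_top : ramIndex K v =
    (valueSubgroup v (algebraMap K L).fieldRange).relIndex (valueSubgroup v ⊤) := by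
  have h := ramIndex_comap (F := K) v (RingHom.id L)
  rwa [RingHom.fieldRange_id, RingHom.id_comp] at h

theorem ramIndex_intermediateField (M : IntermediateField K L) : ramIndex K (resVal M v) =
    (valueSubgroup v (algebraMap K L).fieldRange).relIndex (valueSubgroup v M.toSubfield) := by
  have h := ramIndex_comap (F := K) v (algebraMap M L)
  rwa [M.fieldRange_algebraMap_eq, M.fieldRange_algebraMap_comp] at h

theorem tameSubfield_intermediateField_iff (M : IntermediateField K L) :
    TameSubfield v (algebraMap K L).fieldRange M.toSubfield ↔
      FiniteDimensional K M ∧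
      (ringExpChar (ResField (resVal K (resVal M v)))).Coprime (ramIndex K (resVal M v)) ∧
      Algebra.IsSeparable (ResField (resVal K (resVal M v))) (ResField (resVal M v)) ∧
      Module.finrank K M = ramIndex K (resVal M v) * resDegree K (resVal M v) := by
  have h := tameSubfield_fieldRange_iff (F := K) v (algebraMap M L)
  rwa [M.fieldRange_algebraMap_eq, M.fieldRange_algebraMap_comp] at h

theorem tameSubfield_top_iff :
    TameSubfield v (algebraMap K L).fieldRange ⊤ ↔
      FiniteDimensional K L ∧
      (ringExpChar (ResField (resVal K v))).Coprime (ramIndex K v) ∧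
      Algebra.IsSeparable (ResField (resVal K v)) (ResField v) ∧
      Module.finrank K L = ramIndex K v * resDegree K v := by
  have h := tameSubfield_fieldRange_iff (F := K) v (RingHom.id L)
  rwa [RingHom.fieldRange_id, RingHom.id_comp] at h

/-- A finite extension is tame as soon as the whole extension satisfies the conditions. -/
theorem isTameExt_iff_of_finiteDimensional [FiniteDimensional K L] :
    IsTameExt K v ↔ TameSubfield v (algebraMap K L).fieldRange ⊤ := by
  constructor
  · intro h
    have := (tameSubfield_intermediateField_iff v (⊤ : IntermediateField K L)).2
      ⟨inferInstance, h.2 ⊤ inferInstance⟩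
    exact this
  · intro h
    refine ⟨Algebra.IsAlgebraic.of_finite K L, fun M _ => ?_⟩
    have hKM : (algebraMap K L).fieldRange ≤ M.toSubfield := by
      rintro _ ⟨x, rfl⟩
      exact M.algebraMap_mem x
    exact ((tameSubfield_intermediateField_iff v M).1 (h.tower hKM le_top).1).2

theorem IsTameExt.tameSubfield {M : IntermediateField K L} [FiniteDimensional K M]
    (h : IsTameExt K (resVal M v)) :
    TameSubfield v (algebraMap K L).fieldRange M.toSubfield := by
  have h1 := (tameSubfield_top_iff (resVal M v)).1 ((isTameExt_iff_of_finiteDimensional _).1 h)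
  exact (tameSubfield_intermediateField_iff v M).2 h1

theorem ramIndex_mul_ramIndex (M : IntermediateField K L) :
    ramIndex K (resVal M v) * ramIndex M v = ramIndex K v := by
  have hKM : (algebraMap K L).fieldRange ≤ M.toSubfield := by
    rintro _ ⟨x, rfl⟩
    exact M.algebraMap_mem x
  rw [ramIndex_intermediateField, ramIndex_eq_relIndex_top, ramIndex_eq_relIndex_top,
    M.fieldRange_algebraMap_eq]
  exact Subgroup.relIndex_mul_relIndex _ _ _ (valueSubgroup_mono v hKM)
    (valueSubgroup_mono v le_top)

theorem valGroup_eq_iff_ramIndex_eq_one :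
    valGroup v = valGroup (resVal K v) ↔ ramIndex K v = 1 := by
  have hle : valGroup (resVal K v) ≤ valGroup v := by
    have h1 := valGroup_comap v (RingHom.id L)
    have h2 := valGroup_comap v (algebraMap K L)
    have h3 : valGroup v = valueSubgroup v (RingHom.id L).fieldRange := h1
    rw [h3, h2]
    exact valueSubgroup_mono v fun x _ => ⟨x, rfl⟩
  rw [ramIndex, Subgroup.relIndex_eq_one]
  exact ⟨fun h => h.le, fun h => le_antisymm h hle⟩

theorem IntermediateField.finiteDimensional_of_sup_eq_top {L₁ L₂ : IntermediateField K L}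
    (hL : L₁ ⊔ L₂ = ⊤) [FiniteDimensional K L₁] [FiniteDimensional K L₂] :
    FiniteDimensional K L := by
  have h := IntermediateField.finiteDimensional_sup L₁ L₂
  rw [hL] at h
  exact (IntermediateField.topEquiv (F := K) (E := L)).toLinearEquiv.finiteDimensional

/-- The compositum of two finite tame extensions of a henselian field is tame over each of them. -/
theorem tameSubfield_compositum
    (hK : HenselianLocalRing (resVal K v).valuationSubring)
    {L₁ L₂ : IntermediateField K L} (hL : L₁ ⊔ L₂ = ⊤)
    [FiniteDimensional K L₁] [FiniteDimensional K L₂] (htame₁ : IsTameExt K (resVal L₁ v)) :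
    TameSubfield v (algebraMap L₂ L).fieldRange ⊤ := by
  have hfin := IntermediateField.finiteDimensional_of_sup_eq_top hL
  rw [L₂.fieldRange_algebraMap_eq]
  refine (htame₁.tameSubfield v).base_change ?_ (henselianOn_of_henselian v hK) ?_ ?_
  · rintro _ ⟨x, rfl⟩
    exact L₂.algebraMap_mem x
  · rw [Subfield.relfinrank_top_right]
    exact (Module.finrank_pos (R := L₂) (M := L)).ne'
  · rw [← IntermediateField.sup_toSubfield, hL]
    rfl

end Compositum

/-! ### The main theorem -/

theorem lemma4p3 {K L Γ : Type*} [Field K] [Field L] [Algebra K L]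
    [LinearOrderedCommGroupWithZero Γ] (v : Valuation L Γ)
    (hK : HenselianLocalRing (resVal K v).valuationSubring)
    (L₁ L₂ : IntermediateField K L) (hL : L₁ ⊔ L₂ = ⊤)
    (hfin₁ : FiniteDimensional K L₁) (hfin₂ : FiniteDimensional K L₂)
    (htame₁ : IsTameExt K (resVal L₁ v)) (htame₂ : IsTameExt K (resVal L₂ v)) :
    (IsUnramifiedExt L₂ v ↔
      ∃ θ : v.valuationSubring,
        ramIndex K (resVal L₂ v) * Module.finrank (ResField (resVal L₁ v)) (resAdjoin L₁ v θ) =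
          ramIndex K (resVal L₁ v) * Module.finrank L₁ L) ∧
    ∀ θ : v.valuationSubring,
      ramIndex K (resVal L₂ v) * Module.finrank (ResField (resVal L₁ v)) (resAdjoin L₁ v θ) =
          ramIndex K (resVal L₁ v) * Module.finrank L₁ L →
        resAdjoin L₁ v θ = ⊤ ∧ ramIndex K (resVal L₁ v) ∣ ramIndex K (resVal L₂ v) := by
  have hfin : FiniteDimensional K L := IntermediateField.finiteDimensional_of_sup_eq_top hL
  have hT₂ := tameSubfield_compositum v hK hL htame₁
  have hT₁ := tameSubfield_compositum v hK (sup_comm L₁ L₂ ▸ hL) htame₂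
  have hext₂ : IsTameExt L₂ v := (isTameExt_iff_of_finiteDimensional v).2 hT₂
  obtain ⟨-, -, hsep, hn⟩ := (tameSubfield_top_iff v).1 hT₁
  obtain ⟨-, -, -, hn₂⟩ := (tameSubfield_top_iff v).1 hT₂
  have he : ramIndex K (resVal L₁ v) * ramIndex L₁ v =
      ramIndex K (resVal L₂ v) * ramIndex L₂ v := by
    rw [ramIndex_mul_ramIndex, ramIndex_mul_ramIndex]
  have hn0 : Module.finrank L₁ L ≠ 0 := Module.finrank_pos.ne'
  have hn0₂ : Module.finrank L₂ L ≠ 0 := Module.finrank_pos.ne'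
  have hn0' : Module.finrank K L₂ ≠ 0 := Module.finrank_pos.ne'
  rw [hn, mul_ne_zero_iff] at hn0
  rw [hn₂, mul_ne_zero_iff] at hn0₂
  have he₂ : ramIndex K (resVal L₂ v) ≠ 0 := by
    rw [((tameSubfield_intermediateField_iff v L₂).1 (htame₂.tameSubfield v)).2.2.2,
      mul_ne_zero_iff] at hn0'
    exact hn0'.1
  have hf : resDegree L₁ v = Module.finrank (ResField (resVal L₁ v)) (ResField v) := rfl
  have hfd : FiniteDimensional (ResField (resVal L₁ v)) (ResField v) :=
    FiniteDimensional.of_finrank_pos (Nat.pos_of_ne_zero hn0.2)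
  have key : ∀ θ : v.valuationSubring,
      ramIndex K (resVal L₂ v) * Module.finrank (ResField (resVal L₁ v)) (resAdjoin L₁ v θ) =
          ramIndex K (resVal L₁ v) * Module.finrank L₁ L →
        resAdjoin L₁ v θ = ⊤ ∧ ramIndex L₂ v = 1 := by
    intro θ hθ
    -- The equation becomes e₂ d_θ = e₂ (e(L/L₂) f(L/L₁)); cancelling e₂ and using d_θ ≤ f(L/L₁)
    -- leaves e(L/L₂) = 1.
    rw [hn, ← mul_assoc, he, mul_assoc] at hθ
    have hd := Nat.eq_of_mul_eq_mul_left (Nat.pos_of_ne_zero he₂) hθ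
    have hle : Module.finrank (ResField (resVal L₁ v)) (resAdjoin L₁ v θ) ≤ resDegree L₁ v :=
      (resAdjoin L₁ v θ).toSubmodule.finrank_le
    have h1 : ramIndex L₂ v = 1 := by
      have : ramIndex L₂ v * resDegree L₁ v ≤ 1 * resDegree L₁ v := by
        rw [one_mul, ← hd]; exact hle
      have := Nat.le_of_mul_le_mul_right this (Nat.pos_of_ne_zero hn0.2)
      have := hn0₂.1
      omega
    refine ⟨?_, h1⟩
    rw [h1, one_mul, hf] at hd
    exact IntermediateField.eq_of_le_of_finrank_eq le_top
      (hd.trans IntermediateField.finrank_top'.symm)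
  refine ⟨⟨fun h => ?_, fun ⟨θ, hθ⟩ => ⟨hext₂, ?_⟩⟩, fun θ hθ => ⟨(key θ hθ).1, ?_⟩⟩
  · rw [(valGroup_eq_iff_ramIndex_eq_one v).1 h.2, mul_one] at he
    -- The primitive element exists because tameness of `L/L₁` makes the residue extension finite
    -- and separable.
    obtain ⟨ξ, hξ⟩ := Field.exists_primitive_element (ResField (resVal L₁ v)) (ResField v)
    obtain ⟨θ, rfl⟩ := residue_surjective ξ
    refine ⟨θ, ?_⟩
    rw [resAdjoin, hξ, IntermediateField.finrank_top', ← hf, hn, ← he, mul_assoc]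
  · exact (valGroup_eq_iff_ramIndex_eq_one v).2 (key θ hθ).2
  · rw [(key θ hθ).2, mul_one] at he
    exact ⟨_, he.symm⟩
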